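/- Let $G$ be a group. Monoids and semirings are commutative and have units. A Mackey system $(\mathcal C,\mathcal O)$ on $G$ consists of a set $\mathcal C$ of subgroups of $G$ closed under conjugation and finite intersections, and, for each $H\in\mathcal C$, a set $\mathcal O(H)$ of subgroups $U\in\mathcal C$ with $U\le H$ such that $[H:U]<\infty$, $\mathcal O(U)\subseteq\mathcal O(H)$, $\mathcal O(gHg^{-1})=g\mathcal O(H)g^{-1}$ and $U\cap V\in\mathcal O(V)$ for all $H\in\mathcal C$, $U\in\mathcal O(H)$, $V\in\mathcal C$ with $V\le H$, and $g\in G$. A Tambara system $(\mathcal C,\mathcal O_{\mathcal C},\mathcal O_\bullet)$ on $G$ is given by a set $\widetilde{\mathcal C}$ of subsets of $G$ closed under left and right translations, finite intersections and finite unions, with $\mathcal C=\{H\in\widetilde{\mathcal C}\mid H\le G\}$ and $\mathcal O_{\mathcal C}(H)=\{U\in\mathcal C\mid U\le H,\ [H:U]<\infty\}$, and a Mackey system $(\mathcal C,\mathcal O_\bullet)$ with $H\in\mathcal O_\bullet(H)$ for all $H\in\mathcal C$. Let ${}_G\mathit{Set}_{\mathcal C}$ be the category of all $G$-sets whose point stabilizers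 $G_x$ lie in $\mathcal C$, with all $G$-equivariant maps. For a Mackey system $(\mathcal C,\mathcal O)$, call $f\colon X\to Y$ an $\mathcal O$-map if $f$ has finite fibres and $G_x\in\mathcal O(G_{f(x)})$ for all $x\in X$ (for $\mathcal O=\mathcal O_{\mathcal C}$: if $f$ has finite fibres). A semi-Mackey functor $M$ on $(\mathcal C,\mathcal O)$ consists of monoids $M(X)$, contravariantly functorial monoid homomorphisms $M^*(f)$ for all maps $f$, and covariantly functorial monoid homomorphisms $M_*(f)$ for all $\mathcal O$-maps $f$, such that $M^*(f)M_*(g)=M_*(g')M^*(f')$ for every pull-back square (where $g$ is an $\mathcal O$-map, $g'$ is the pull-back of $g$ by $f$, and $f'$ that of $f$ by $g$), and such that $M(X)\to\prod_\lambda M(X_\lambda)$ is an isomorphism for every (possibly infinite) disjoint union decomposition $X=\coprod_\lambda X_\lambda$. Morphisms are families of monoid homomorphisms compatible with all $M^*(f)$ and $M_*(f)$. Let $\mathit{SMack}$ be the category of semi-Mackey functors on $(\mathcal C,\mathcal O_\bullet)$. For an $\mathcal O_\bullet$-map $\eta\colon X\to Y$ and $p\colon A\to X$ with finite fibres let $\Pi_\eta(A)$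 be the $G$-set of pairs $(y,\sigma)$ with $y\in Y$ and $\sigma\colon\eta^{-1}(y)\to A$ a map of sets with $p\sigma=\mathrm{id}$, with maps $\pi\colon\Pi_\eta(A)\to Y$, $(y,\sigma)\mapsto y$; $\lambda\colon X\times_Y\Pi_\eta(A)\to A$, $(x,(y,\sigma))\mapsto\sigma(x)$; and the projection $\rho\colon X\times_Y\Pi_\eta(A)\to\Pi_\eta(A)$. A diagram isomorphic to $(\eta,p,\lambda,\rho,\pi)$ is called exponential. A semi-Tambara functor $S=(S^*,S_+,S_\bullet)$ consists of semirings $S(X)$ such that $(S^*,S_+)$ is a semi-Mackey functor on $(\mathcal C,\mathcal O_{\mathcal C})$ for the additive monoids, $(S^*,S_\bullet)$ is a semi-Mackey functor on $(\mathcal C,\mathcal O_\bullet)$ for the multiplicative monoids, and $S_+(\upsilon)S_\bullet(\eta')S^*(\zeta)=S_\bullet(\eta)S_+(\xi)$ for every exponential diagram $(\eta\colon X\to Y,\ \xi\colon Z\to X,\ \zeta\colon X'\to Z,\ \eta'\colon X'\to Y',\ \upsilon\colon Y'\to Y)$. Morphisms are families of semiring homomorphisms compatible with $S^*,S_+,S_\bullet$;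 this gives the category $\mathit{STam}$. For $M\in\mathit{SMack}$ and $X\in{}_G\mathit{Set}_{\mathcal C}$ consider pairs $(A\xrightarrow{p}X,m)$ with $p$ of finite fibres and $m\in M(A)$. An isomorphism from $(A_1\xrightarrow{p_1}X,m_1)$ to $(A_2\xrightarrow{p_2}X,m_2)$ is an isomorphism $f\colon A_1\to A_2$ over $X$ with $M^*(f)(m_2)=m_1$. **Theorem.** For every Tambara system on every group $G$ there is a functor $\mathcal S\colon\mathit{SMack}\to\mathit{STam}$, $M\mapsto\mathcal S_M$, such that $\mathcal S_M(X)$ is the set of isomorphism classes of the above pairs, with semiring and functor structure $$(A_1\xrightarrow{p_1}X,m_1)+(A_2\xrightarrow{p_2}X,m_2)=(A_1\amalg A_2\to X,\ m_1\amalg m_2),$$ $$(A_1\xrightarrow{p_1}X,m_1)\cdot(A_2\xrightarrow{p_2}X,m_2)=(A_1\times_XA_2\to X,\ M^*(\mathrm{pr}_1)(m_1)\cdot M^*(\mathrm{pr}_2)(m_2)),$$ where $m_1\amalg m_2\in M(A_1\amalg A_2)$ is the element with restrictions $m_1$ and $m_2$; $$\zeta^*(A\xrightarrow{p}X,m)=(A\times_XY\to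 Y,\ M^*(\mathrm{pr}_1)(m))\quad\text{for every map }\zeta\colon Y\to X,$$ $$\xi_+(A\xrightarrow{p}X,m)=(A\xrightarrow{\xi p}Y,\ m)\quad\text{for every }\xi\colon X\to Y\text{ with finite fibres},$$ $$\eta_\bullet(A\xrightarrow{p}X,m)=(\Pi_\eta(A)\xrightarrow{\pi}Y,\ M_*(\rho)M^*(\lambda)(m))\quad\text{for every }\mathcal O_\bullet\text{-map }\eta\colon X\to Y,$$ and, for every morphism $\varphi\colon M\to N$ in $\mathit{SMack}$, $$\mathcal S_\varphi(A\xrightarrow{p}X,m)=(A\xrightarrow{p}X,\ \varphi_A(m)).$$ In particular all these operations are well defined on isomorphism classes, each $\mathcal S_M$ is a semi-Tambara functor, and each $\mathcal S_\varphi$ is a family of semiring homomorphisms commuting with all structure maps. -/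

import Mathlib

open CategoryTheory
open scoped Pointwise

universe u

namespace Tambarization

variable {G : Type u} [Group G]

/-! ## Mackey systems and Tambara systems -/

/-- A set `C` of subgroups of `G` closed under conjugation and (binary, hence nonempty finite)
intersections. -/
structure SubgroupFamily (G : Type u) [Group G] where
  C : Set (Subgroup G)
  conj_mem : ∀ (g : G) {H : Subgroup G}, H ∈ C → MulAut.conj g • H ∈ C
  inf_mem : ∀ {H K : Subgroup G}, H ∈ C → K ∈ C → H ⊓ K ∈ C

/-- A Mackey system `(C, O)` with given first component `C`.  Only the values `O H` with `H ∈ C`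
matter.  `U.relIndex H ≠ 0` says that `[H : U]` is finite. -/
structure MackeySystem (F : SubgroupFamily G) where
  O : Subgroup G → Set (Subgroup G)
  mem_C : ∀ {H U : Subgroup G}, H ∈ F.C → U ∈ O H → U ∈ F.C
  le : ∀ {H U : Subgroup G}, H ∈ F.C → U ∈ O H → U ≤ H
  finite_index : ∀ {H U : Subgroup G}, H ∈ F.C → U ∈ O H → U.relIndex H ≠ 0
  subset : ∀ {H U : Subgroup G}, H ∈ F.C → U ∈ O H → O U ⊆ O H
  conj : ∀ (g : G) {H : Subgroup G}, H ∈ F.C →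
    O (MulAut.conj g • H) = (fun U : Subgroup G => MulAut.conj g • U) '' O H
  inf_mem : ∀ {H U V : Subgroup G}, H ∈ F.C → U ∈ O H → V ∈ F.C → V ≤ H → U ⊓ V ∈ O V

/-- The Mackey system `(C, O_C)`, where `O_C(H)` consists of all `U ∈ C` contained in `H` with
finite index. -/
def SubgroupFamily.natural (F : SubgroupFamily G) : MackeySystem F where
  O H := {U | U ∈ F.C ∧ U ≤ H ∧ U.relIndex H ≠ 0}
  mem_C _ h := h.1
  le _ h := h.2.1
  finite_index _ h := h.2.2
  subset _ h _ hW :=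
    ⟨hW.1, hW.2.1.trans h.2.1, Subgroup.relIndex_ne_zero_trans hW.2.2 h.2.2⟩
  conj g H _ := by
    have key : ∀ (c : MulAut G) (U K : Subgroup G), (c • U).relIndex (c • K) = U.relIndex K :=
      fun c U K => Subgroup.relIndex_map_map_of_injective U K (f := c.toMonoidHom) c.injective
    ext U
    constructor
    · rintro ⟨h1, h2, h3⟩
      have e : MulAut.conj g • (MulAut.conj g⁻¹ • U) = U := by
        rw [map_inv, smul_inv_smul]
      refine ⟨MulAut.conj g⁻¹ • U, ⟨F.conj_mem _ h1, ?_, ?_⟩, e⟩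
      · rw [map_inv]
        exact Subgroup.pointwise_smul_le_pointwise_smul_iff.1
          (show MulAut.conj g • ((MulAut.conj g)⁻¹ • U) ≤ MulAut.conj g • H by
            rw [smul_inv_smul]; exact h2)
      · rw [← key (MulAut.conj g), e]
        exact h3
    · rintro ⟨V, ⟨h1, h2, h3⟩, rfl⟩
      exact ⟨F.conj_mem _ h1, Subgroup.pointwise_smul_le_pointwise_smul_iff.2 h2,
        by rw [key]; exact h3⟩
  inf_mem {H U V} _ hU hV hVH := by
    refine ⟨F.inf_mem hU.1 hV, inf_le_right, ?_⟩
    rw [Subgroup.inf_relIndex_right]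
    exact fun h => hU.2.2 (Subgroup.relIndex_eq_zero_of_le_right hVH h)

/-- A set of subsets of `G` closed under left and right translation, and under (binary, hence
nonempty finite) intersections and unions. -/
structure SubsetFamily (G : Type u) [Group G] where
  sets : Set (Set G)
  left_mem : ∀ (g : G) {s : Set G}, s ∈ sets → (fun x => g * x) '' s ∈ sets
  right_mem : ∀ (g : G) {s : Set G}, s ∈ sets → (fun x => x * g) '' s ∈ sets
  inter_mem : ∀ {s t : Set G}, s ∈ sets → t ∈ sets → s ∩ t ∈ sets
  union_mem : ∀ {s t : Set G}, s ∈ sets → t ∈ sets → s ∪ t ∈ sets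

/-- The family of those members of a set of subsets which are subgroups. -/
def SubsetFamily.family (D : SubsetFamily G) : SubgroupFamily G where
  C := {H | (H : Set G) ∈ D.sets}
  conj_mem g H hH := by
    have h := D.right_mem g⁻¹ (D.left_mem g hH)
    have e : ((MulAut.conj g • H : Subgroup G) : Set G)
        = (fun x => x * g⁻¹) '' ((fun x => g * x) '' (H : Set G)) := by
      ext x
      constructor
      · rintro ⟨y, hy, rfl⟩
        exact ⟨g * y, ⟨y, hy, rfl⟩, rfl⟩
      · rintro ⟨_, ⟨y, hy, rfl⟩, rfl⟩
        exact ⟨y, hy, rfl⟩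
    change ((MulAut.conj g • H : Subgroup G) : Set G) ∈ D.sets
    rw [e]
    exact h
  inf_mem hH hK := D.inter_mem hH hK

/-- A Tambara system `(C, O_C, O_•)` on `G`, together with the set of subsets of `G` from which
`C` is obtained. -/
structure TambaraSystem (G : Type u) [Group G] extends SubsetFamily G where
  /-- the Mackey system `(C, O_•)` -/
  mul : MackeySystem toSubsetFamily.family
  self_mem : ∀ {H : Subgroup G}, H ∈ toSubsetFamily.family.C → H ∈ mul.O H

/-- The Mackey system `(C, O_C)` of a Tambara system. -/
abbrev TambaraSystem.plus (T : TambaraSystem G) : MackeySystem T.family := T.family.natural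

/-! ## The category of `G`-sets with stabilizers in `C` -/

/-- A `G`-set all of whose stabilizers are in `C`. -/
structure GSet (F : SubgroupFamily G) : Type (u + 1) where
  carrier : Type u
  [action : MulAction G carrier]
  stab_mem : ∀ x : carrier, MulAction.stabilizer G x ∈ F.C

namespace GSet

variable {F : SubgroupFamily G}

instance : CoeSort (GSet F) (Type u) := ⟨GSet.carrier⟩

instance (X : GSet F) : MulAction G X := X.action

/-- Morphisms are all `G`-equivariant maps. -/
instance : Category (GSet F) where
  Hom X Y := X →[G] Y
  id X := MulActionHom.id G
  comp f g := MulActionHom.comp g f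

instance : ConcreteCategory (GSet F) (fun X Y => X →[G] Y) where
  hom f := f
  ofHom f := f

lemma map_smul' {X Y : GSet F} (f : X ⟶ Y) (g : G) (x : X) : f (g • x) = g • f x :=
  map_smul (ConcreteCategory.hom f) g x

/-- The morphism given by an equivariant map. -/
def mk' {X Y : GSet F} (f : X → Y) (hf : ∀ (g : G) (x : X), f (g • x) = g • f x) : X ⟶ Y :=
  ConcreteCategory.ofHom (C := GSet F) (X := X) (Y := Y) ⟨f, hf⟩

@[simp] lemma mk'_apply {X Y : GSet F} (f : X → Y) (hf) (x : X) :
    (mk' f hf : X ⟶ Y) x = f x := rfl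

lemma stabilizer_le {X Y : GSet F} (f : X ⟶ Y) (x : X) :
    MulAction.stabilizer G x ≤ MulAction.stabilizer G (f x) := by
  intro g hg
  rw [MulAction.mem_stabilizer_iff] at hg ⊢
  rw [← map_smul', hg]

/-- The fibre product `A ×_X B`. -/
def fiberProd {A B X : GSet F} (p : A ⟶ X) (q : B ⟶ X) : GSet F where
  carrier := {z : A × B // p z.1 = q z.2}
  action :=
    { smul := fun g z => ⟨(g • z.1.1, g • z.1.2), by
        change p (g • z.1.1) = q (g • z.1.2)
        rw [map_smul', map_smul', z.2]⟩
      one_smul := fun z => Subtype.ext (Prod.ext (one_smul G z.1.1) (one_smul G z.1.2))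
      mul_smul := fun g h z =>
        Subtype.ext (Prod.ext (mul_smul g h z.1.1) (mul_smul g h z.1.2)) }
  stab_mem z := by
    convert F.inf_mem (A.stab_mem z.1.1) (B.stab_mem z.1.2)
    ext g
    exact Subtype.ext_iff.trans Prod.ext_iff

/-- The projection `A ×_X B ⟶ A`. -/
def fiberProd.fst {A B X : GSet F} (p : A ⟶ X) (q : B ⟶ X) : fiberProd p q ⟶ A :=
  mk' (fun z => z.1.1) (fun _ _ => rfl)

/-- The projection `A ×_X B ⟶ B`. -/
def fiberProd.snd {A B X : GSet F} (p : A ⟶ X) (q : B ⟶ X) : fiberProd p q ⟶ B :=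
  mk' (fun z => z.1.2) (fun _ _ => rfl)

/-- The disjoint union `A ⨿ B`. -/
def sum (A B : GSet F) : GSet F where
  carrier := A ⊕ B
  stab_mem z := by
    rcases z with a | b
    · convert A.stab_mem a
      ext g
      simp [MulAction.mem_stabilizer_iff]
    · convert B.stab_mem b
      ext g
      simp [MulAction.mem_stabilizer_iff]

/-- The inclusion `A ⟶ A ⨿ B`. -/
def sum.inl (A B : GSet F) : A ⟶ sum A B := mk' Sum.inl (fun _ _ => rfl)

/-- The inclusion `B ⟶ A ⨿ B`. -/
def sum.inr (A B : GSet F) : B ⟶ sum A B := mk' Sum.inr (fun _ _ => rfl)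

/-- The map `p ∪ q : A ⨿ B ⟶ X`. -/
def sum.desc {A B X : GSet F} (p : A ⟶ X) (q : B ⟶ X) : sum A B ⟶ X :=
  mk' (Sum.elim p q) (by
    rintro g (a | b)
    · exact map_smul' p g a
    · exact map_smul' q g b)

/-- A family of morphisms `i l : X' l ⟶ X` exhibits `X` as the direct sum (disjoint union) of the
`X' l`. -/
def IsDecomposition {L : Type u} {X : GSet F} {X' : L → GSet F} (i : ∀ l, X' l ⟶ X) : Prop :=
  Function.Bijective (fun z : Σ l, X' l => i z.1 z.2)

end GSet

open GSet

/-! ## Transfer morphisms -/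

namespace MackeySystem

variable {F : SubgroupFamily G}

/-- Membership of `f` in the subcategory attached to `(C, O)`: finite fibres, and
`G_x ∈ O(G_{f(x)})` for all `x`. -/
def IsTransfer (S : MackeySystem F) {X Y : GSet F} (f : X ⟶ Y) : Prop :=
  (∀ y : Y, {x : X | f x = y}.Finite) ∧
    ∀ x : X, MulAction.stabilizer G x ∈ S.O (MulAction.stabilizer G (f x))

lemma IsTransfer.comp {S : MackeySystem F} {X Y Z : GSet F} {f : X ⟶ Y} {g : Y ⟶ Z}
    (hf : S.IsTransfer f) (hg : S.IsTransfer g) : S.IsTransfer (f ≫ g) := by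
  refine ⟨fun z => ?_, fun x => ?_⟩
  · refine ((hg.1 z).biUnion (fun y _ => hf.1 y)).subset ?_
    intro x hx
    exact Set.mem_biUnion (x := f x) (show g (f x) = z from hx) rfl
  · exact S.subset (Z.stab_mem _) (hg.2 (f x)) (hf.2 x)

/-- Transfer morphisms are stable under base change. -/
lemma IsTransfer.snd {S : MackeySystem F} {A B X : GSet F} {p : A ⟶ X}
    (hp : S.IsTransfer p) (q : B ⟶ X) : S.IsTransfer (fiberProd.snd p q) := by
  refine ⟨fun b => ?_, fun z => ?_⟩
  · refine Set.Finite.of_finite_image (f := fun z : fiberProd p q => z.1.1)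
      ((hp.1 (q b)).subset ?_) ?_
    · rintro _ ⟨z, hz, rfl⟩
      have h1 : z.1.2 = b := hz
      change p z.1.1 = q b
      rw [← h1]
      exact z.2
    · intro z hz w hw h
      have h1 : z.1.2 = b := hz
      have h2 : w.1.2 = b := hw
      exact Subtype.ext (Prod.ext h (h1.trans h2.symm))
  · have h := S.inf_mem (X.stab_mem _) (hp.2 z.1.1) (B.stab_mem z.1.2)
      (by rw [z.2]; exact stabilizer_le q z.1.2)
    change MulAction.stabilizer G z ∈ S.O (MulAction.stabilizer G z.1.2)
    convert h
    ext g
    rw [Subgroup.mem_inf, MulAction.mem_stabilizer_iff, MulAction.mem_stabilizer_iff,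
      MulAction.mem_stabilizer_iff]
    exact Subtype.ext_iff.trans Prod.ext_iff

/-- For `(C, O_C)`, the condition is just that `f` has finite fibres. -/
lemma isTransfer_natural {X Y : GSet F} {f : X ⟶ Y} (h : ∀ y : Y, {x : X | f x = y}.Finite) :
    F.natural.IsTransfer f := by
  refine ⟨h, fun x => ⟨X.stab_mem x, stabilizer_le f x, ?_⟩⟩
  have e : (MulAction.stabilizer G x).subgroupOf (MulAction.stabilizer G (f x))
      = MulAction.stabilizer (MulAction.stabilizer G (f x)) x := by
    ext g
    rfl
  have hfin : (MulAction.orbit (MulAction.stabilizer G (f x)) x).Finite := by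
    refine (h (f x)).subset ?_
    rintro _ ⟨g, rfl⟩
    change f (g.1 • x) = f x
    rw [map_smul']
    exact g.2
  rw [Subgroup.relIndex, e, MulAction.index_stabilizer]
  exact (Set.ncard_pos hfin).2 (MulAction.nonempty_orbit x) |>.ne'

end MackeySystem

open MackeySystem

/-! ## Semi-Mackey functors -/

/-- Monoids `obj X`, contravariant maps `res f = M^*(f)` for all `f`, and covariant maps
`tr f = M_*(f)` for the transfer morphisms `f` of `(C, O)`, form a semi-Mackey functor. -/
structure IsSemiMackey {F : SubgroupFamily G} (S : MackeySystem F) (obj : GSet F → Type u)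
    [∀ X, CommMonoid (obj X)] (res : ∀ {X Y : GSet F}, (X ⟶ Y) → (obj Y →* obj X))
    (tr : ∀ {X Y : GSet F} (f : X ⟶ Y), S.IsTransfer f → (obj X →* obj Y)) : Prop where
  res_id : ∀ (X : GSet F) (m : obj X), res (𝟙 X) m = m
  res_comp : ∀ {X Y Z : GSet F} (f : X ⟶ Y) (g : Y ⟶ Z) (m : obj Z),
    res (f ≫ g) m = res f (res g m)
  tr_id : ∀ (X : GSet F) (h : S.IsTransfer (𝟙 X)) (m : obj X), tr (𝟙 X) h m = m
  tr_comp : ∀ {X Y Z : GSet F} (f : X ⟶ Y) (g : Y ⟶ Z) (hf : S.IsTransfer f)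
    (hg : S.IsTransfer g) (m : obj X), tr (f ≫ g) (hf.comp hg) m = tr g hg (tr f hf m)
  /-- the Mackey condition (that `g'` is a transfer morphism is automatic) -/
  mackey : ∀ {X Y X' Y' : GSet F} {g' : X' ⟶ Y'} {f' : X' ⟶ X} {f : Y' ⟶ Y} {g : X ⟶ Y},
    IsPullback g' f' f g → ∀ (hg : S.IsTransfer g) (hg' : S.IsTransfer g') (m : obj X),
      res f (tr g hg m) = tr g' hg' (res f' m)
  /-- additivity, for arbitrary direct sum decompositions -/
  additive : ∀ {L : Type u} {X : GSet F} {X' : L → GSet F} (i : ∀ l, X' l ⟶ X),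
    IsDecomposition i →
      Function.Bijective (fun (m : obj X) (l : L) => (res (i l) m : obj (X' l)))

/-- A semi-Mackey functor on `(C, O)`. -/
structure SemiMackey {F : SubgroupFamily G} (S : MackeySystem F) : Type (u + 1) where
  obj : GSet F → Type u
  [monoid : ∀ X, CommMonoid (obj X)]
  res : ∀ {X Y : GSet F}, (X ⟶ Y) → (obj Y →* obj X)
  tr : ∀ {X Y : GSet F} (f : X ⟶ Y), S.IsTransfer f → (obj X →* obj Y)
  isSemiMackey : IsSemiMackey S obj res tr

namespace SemiMackey

variable {F : SubgroupFamily G} {S : MackeySystem F}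

instance (M : SemiMackey S) (X : GSet F) : CommMonoid (M.obj X) := M.monoid X

/-- A morphism of semi-Mackey functors. -/
@[ext] structure Hom (M N : SemiMackey S) : Type (u + 1) where
  app : ∀ X : GSet F, M.obj X →* N.obj X
  res_app : ∀ {X Y : GSet F} (f : X ⟶ Y) (m : M.obj Y),
    app X (M.res f m) = N.res f (app Y m)
  tr_app : ∀ {X Y : GSet F} (f : X ⟶ Y) (hf : S.IsTransfer f) (m : M.obj X),
    app Y (M.tr f hf m) = N.tr f hf (app X m)

/-- The category of semi-Mackey functors on `(C, O)`. -/
instance : Category (SemiMackey S) where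
  Hom := Hom
  id M := ⟨fun X => MonoidHom.id (M.obj X), fun _ _ => rfl, fun _ _ _ => rfl⟩
  comp φ ψ := ⟨fun X => (ψ.app X).comp (φ.app X),
    fun f m => by simp [φ.res_app, ψ.res_app], fun f hf m => by simp [φ.tr_app, ψ.tr_app]⟩

lemma exists_glue (M : SemiMackey S) {A B : GSet F} (a : M.obj A) (b : M.obj B) :
    ∃ m : M.obj (sum A B), M.res (sum.inl A B) m = a ∧ M.res (sum.inr A B) m = b := by
  let X' : ULift.{u} Bool → GSet F := fun l => Bool.rec A B l.down
  let i : ∀ l, X' l ⟶ sum A B := fun l => match l with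
    | ⟨false⟩ => sum.inl A B
    | ⟨true⟩ => sum.inr A B
  have hi : IsDecomposition i := by
    constructor
    · rintro ⟨⟨_ | _⟩, x⟩ ⟨⟨_ | _⟩, y⟩ h
      · have h' : (Sum.inl x : A ⊕ B) = Sum.inl y := h
        cases h'
        rfl
      · have h' : (Sum.inl x : A ⊕ B) = Sum.inr y := h
        cases h'
      · have h' : (Sum.inr x : A ⊕ B) = Sum.inl y := h
        cases h'
      · have h' : (Sum.inr x : A ⊕ B) = Sum.inr y := h
        cases h'
        rfl
    · rintro (x | x)
      · exact ⟨⟨⟨false⟩, x⟩, rfl⟩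
      · exact ⟨⟨⟨true⟩, x⟩, rfl⟩
  obtain ⟨m, hm⟩ := (M.isSemiMackey.additive i hi).2 (fun l => match l with
    | ⟨false⟩ => a
    | ⟨true⟩ => b)
  exact ⟨m, congrFun hm ⟨false⟩, congrFun hm ⟨true⟩⟩

/-- The element `a ⨿ b ∈ M(A ⨿ B)` corresponding to `(a, b) ∈ M(A) × M(B)`; it is the only element
with restrictions `a` and `b`, by additivity of `M`. -/
noncomputable def glue (M : SemiMackey S) {A B : GSet F} (a : M.obj A) (b : M.obj B) :
    M.obj (sum A B) := (M.exists_glue a b).choose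

end SemiMackey

/-! ## Exponential diagrams -/

section Exponential

variable {F : SubgroupFamily G}

/-- The set `Π_η(A)` of pairs `(y, σ)` of a point `y` of `Y` and a map of sets
`σ : η⁻¹(y) → A` with `p ∘ σ = id`. -/
structure PiSet {X Y A : GSet F} (η : X ⟶ Y) (p : A ⟶ X) : Type u where
  base : Y
  sec : ∀ x : X, η x = base → A
  p_sec : ∀ (x : X) (h : η x = base), p (sec x h) = x

namespace PiSet

variable {X Y A : GSet F} {η : X ⟶ Y} {p : A ⟶ X}

lemma ext' {s t : PiSet η p} (hb : s.base = t.base)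
    (hs : ∀ (x : X) (h : η x = s.base) (h' : η x = t.base), s.sec x h = t.sec x h') : s = t := by
  obtain ⟨b, σ, hσ⟩ := s
  obtain ⟨c, τ, hτ⟩ := t
  obtain rfl : b = c := hb
  obtain rfl : σ = τ := by
    funext x h
    exact hs x h h
  rfl

lemma sec_congr (s : PiSet η p) {x x' : X} (e : x = x') (h : η x = s.base)
    (h' : η x' = s.base) : s.sec x h = s.sec x' h' := by
  subst e
  rfl

lemma inv_smul_mem {b : Y} {g : G} {x : X} (h : η x = g • b) : η (g⁻¹ • x) = b := by
  rw [map_smul', h, inv_smul_smul]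

/-- `g • (y, σ) = (g y, x ↦ g σ(g⁻¹ x))`. -/
instance : MulAction G (PiSet η p) where
  smul g s :=
    { base := g • s.base
      sec := fun x h => g • s.sec (g⁻¹ • x) (inv_smul_mem h)
      p_sec := fun x h => by rw [map_smul', s.p_sec, smul_inv_smul] }
  one_smul s := by
    refine ext' (one_smul G s.base) (fun x h h' => ?_)
    change (1 : G) • s.sec ((1 : G)⁻¹ • x) _ = s.sec x h'
    rw [one_smul]
    exact s.sec_congr (by simp) _ _
  mul_smul g k s := by
    refine ext' (mul_smul g k s.base) (fun x h h' => ?_)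
    change (g * k) • s.sec ((g * k)⁻¹ • x) _ = g • (k • s.sec (k⁻¹ • (g⁻¹ • x)) _)
    rw [mul_smul]
    exact congrArg (fun a => g • k • a) (s.sec_congr (by rw [mul_inv_rev, mul_smul]) _ _)

lemma smul_base (g : G) (s : PiSet η p) : (g • s).base = g • s.base := rfl

lemma smul_sec (g : G) (s : PiSet η p) (x : X) (h : η x = (g • s).base) :
    (g • s).sec x h = g • s.sec (g⁻¹ • x) (inv_smul_mem h) := rfl

lemma mem_stabilizer_iff (s : PiSet η p) (g : G) :
    g ∈ MulAction.stabilizer G s ↔ g ∈ MulAction.stabilizer G s.base ∧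
      ∀ z : {x : X // η x = s.base}, ∃ w : {x : X // η x = s.base},
        g • s.sec z.1 z.2 = s.sec w.1 w.2 := by
  rw [MulAction.mem_stabilizer_iff, MulAction.mem_stabilizer_iff]
  constructor
  · intro h
    have hb : g • s.base = s.base := congrArg PiSet.base h
    refine ⟨hb, fun z => ⟨⟨g • z.1, by rw [map_smul', z.2, hb]⟩, ?_⟩⟩
    have key : ∀ t : PiSet η p, t = s → ∀ (x : X) (h1 : η x = t.base) (h2 : η x = s.base),
        t.sec x h1 = s.sec x h2 := by
      rintro t rfl x _ _
      rfl
    rw [← key _ h (g • z.1) (by rw [smul_base, map_smul', z.2]), smul_sec]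
    exact congrArg (fun a => g • a) (s.sec_congr (by simp) _ _)
  · rintro ⟨hb, hw⟩
    refine ext' hb (fun x h h' => ?_)
    rw [smul_sec]
    obtain ⟨w, e⟩ := hw ⟨g⁻¹ • x, inv_smul_mem h⟩
    rw [e]
    refine s.sec_congr ?_ _ _
    have := congrArg p e
    rw [map_smul', s.p_sec, s.p_sec, smul_inv_smul] at this
    exact this.symm

end PiSet

end Exponential

/-- `{g | g a = b}` is empty or a coset of the stabilizer of `a`. -/
lemma transporter_mem (D : SubsetFamily G) {A : GSet D.family} (a b : A) :
    {g : G | g • a = b} = ∅ ∨ {g : G | g • a = b} ∈ D.sets := by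
  rcases Set.eq_empty_or_nonempty {g : G | g • a = b} with h | ⟨k, hk⟩
  · exact Or.inl h
  · right
    have e : {g : G | g • a = b} = (fun x => k * x) '' (MulAction.stabilizer G a : Set G) := by
      have hk' : k • a = b := hk
      ext g
      constructor
      · intro hg
        have hg' : g • a = b := hg
        refine ⟨k⁻¹ * g, ?_, by simp⟩
        change (k⁻¹ * g) • a = a
        rw [mul_smul, hg', ← hk', inv_smul_smul]
      · rintro ⟨x, hx, rfl⟩
        have hx' : x • a = a := hx
        change (k * x) • a = b
        rw [mul_smul, hx', hk']
    rw [e]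
    exact D.left_mem k (A.stab_mem a)

namespace SubsetFamily

lemma iUnion_mem (D : SubsetFamily G) {I : Type u} (J : Finset I) (s : I → Set G)
    (h : ∀ i, s i = ∅ ∨ s i ∈ D.sets) : (⋃ i ∈ J, s i) = ∅ ∨ (⋃ i ∈ J, s i) ∈ D.sets := by
  classical
  induction J using Finset.induction_on with
  | empty => simp
  | insert i J _ ih =>
    rw [Finset.set_biUnion_insert]
    rcases h i with h1 | h1
    · rw [h1, Set.empty_union]
      exact ih
    · rcases ih with h2 | h2
      · rw [h2, Set.union_empty]
        exact Or.inr h1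
      · exact Or.inr (D.union_mem h1 h2)

lemma iInter_mem (D : SubsetFamily G) {I : Type u} (J : Finset I) (t : Set G) (ht : t ∈ D.sets)
    (s : I → Set G) (h : ∀ i, s i ∈ D.sets) : (t ∩ ⋂ i ∈ J, s i) ∈ D.sets := by
  classical
  induction J using Finset.induction_on with
  | empty => simpa using ht
  | insert i J _ ih =>
    rw [Finset.set_biInter_insert, Set.inter_left_comm]
    exact D.inter_mem (h i) ih

end SubsetFamily

namespace TambaraSystem

variable (T : TambaraSystem G) {X Y A : GSet T.family}

lemma stabilizer_piSet_mem {η : X ⟶ Y} (hη : T.mul.IsTransfer η) (p : A ⟶ X) (s : PiSet η p) :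
    MulAction.stabilizer G s ∈ T.family.C := by
  classical
  have : Finite {x : X // η x = s.base} := (hη.1 s.base).to_subtype
  let _ : Fintype {x : X // η x = s.base} := Fintype.ofFinite _
  have e : (MulAction.stabilizer G s : Set G) = (MulAction.stabilizer G s.base : Set G) ∩
      ⋂ z ∈ (Finset.univ : Finset {x : X // η x = s.base}),
        ⋃ w ∈ (Finset.univ : Finset {x : X // η x = s.base}),
          {g : G | g • s.sec z.1 z.2 = s.sec w.1 w.2} := by
    ext g
    rw [SetLike.mem_coe, PiSet.mem_stabilizer_iff]
    simp
  change (MulAction.stabilizer G s : Set G) ∈ T.sets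
  rw [e]
  refine T.iInter_mem _ _ (Y.stab_mem s.base) _ (fun z => ?_)
  refine (T.iUnion_mem _ _ (fun w => transporter_mem T.toSubsetFamily _ _)).resolve_left ?_
  refine Set.Nonempty.ne_empty ⟨1, ?_⟩
  simp only [Finset.mem_univ, Set.iUnion_true, Set.mem_iUnion]
  exact ⟨z, one_smul G _⟩

/-- The `G`-set `Π_η(A)`. -/
def pi (η : X ⟶ Y) (hη : T.mul.IsTransfer η) (p : A ⟶ X) : GSet T.family where
  carrier := PiSet η p
  stab_mem := T.stabilizer_piSet_mem hη p

/-- The map `π : Π_η(A) ⟶ Y`, `(y, σ) ↦ y`. -/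
def piMap (η : X ⟶ Y) (hη : T.mul.IsTransfer η) (p : A ⟶ X) : T.pi η hη p ⟶ Y :=
  mk' (X := T.pi η hη p) PiSet.base (fun _ _ => rfl)

/-- The evaluation `λ : X ×_Y Π_η(A) ⟶ A`, `(x, (y, σ)) ↦ σ(x)`. -/
def piEval (η : X ⟶ Y) (hη : T.mul.IsTransfer η) (p : A ⟶ X) :
    fiberProd η (T.piMap η hη p) ⟶ A :=
  mk' (X := fiberProd η (T.piMap η hη p)) (fun z => PiSet.sec z.1.2 z.1.1 z.2) (by
    intro g z
    change g • PiSet.sec z.1.2 (g⁻¹ • (g • z.1.1)) _ = _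
    exact congrArg (fun a => g • a) (PiSet.sec_congr _ (by simp) _ _))

/-- The projection `ρ : X ×_Y Π_η(A) ⟶ Π_η(A)`, the pull-back of `η` by `π`. -/
def piProj (η : X ⟶ Y) (hη : T.mul.IsTransfer η) (p : A ⟶ X) :
    fiberProd η (T.piMap η hη p) ⟶ T.pi η hη p :=
  fiberProd.snd η (T.piMap η hη p)

lemma isTransfer_piProj (η : X ⟶ Y) (hη : T.mul.IsTransfer η) (p : A ⟶ X) :
    T.mul.IsTransfer (T.piProj η hη p) :=
  hη.snd _

lemma isTransfer_piMap (η : X ⟶ Y) (hη : T.mul.IsTransfer η) (p : A ⟶ X)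
    (hp : T.plus.IsTransfer p) : T.plus.IsTransfer (T.piMap η hη p) := by
  refine isTransfer_natural (fun y => ?_)
  have : Finite {x : X // η x = y} := (hη.1 y).to_subtype
  have : ∀ x : X, Finite {a : A // p a = x} := fun x => (hp.1 x).to_subtype
  let f : {s : T.pi η hη p | T.piMap η hη p s = y} →
      (∀ z : {x : X // η x = y}, {a : A // p a = z.1}) := fun s z =>
    ⟨PiSet.sec s.1 z.1 (z.2.trans s.2.symm), PiSet.p_sec _ _ _⟩
  refine Set.finite_coe_iff.1 (Finite.of_injective f ?_)
  intro s t h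
  refine Subtype.ext (PiSet.ext' (s.2.trans t.2.symm) (fun x hx hx' => ?_))
  exact congrArg Subtype.val (congrFun h ⟨x, hx.trans s.2⟩)

/-- The diagram
```
  X <--ξ-- Z <--ζ-- X'
  |η                |η'
  Y <------υ------- Y'
```
is an exponential diagram: it is isomorphic (over the given `ξ` and `η`) to the canonical diagram
formed by `Π_η(Z)`, `X ×_Y Π_η(Z)` and the maps `λ`, `ρ`, `π`. -/
def IsExponential {X Y Z X' Y' : GSet T.family} (η : X ⟶ Y) (hη : T.mul.IsTransfer η)
    (ξ : Z ⟶ X) (ζ : X' ⟶ Z) (η' : X' ⟶ Y') (υ : Y' ⟶ Y) : Prop :=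
  ∃ (b : Y' ≅ T.pi η hη ξ) (a : X' ≅ fiberProd η (T.piMap η hη ξ)),
    a.hom ≫ T.piEval η hη ξ = ζ ∧ a.hom ≫ T.piProj η hη ξ = η' ≫ b.hom ∧
      b.hom ≫ T.piMap η hη ξ = υ

end TambaraSystem

/-! ## Semi-Tambara functors -/

/-- A semi-Tambara functor `(S^*, S_+, S_•)`: here `res = S^*`, `add = S_+` and `mul = S_•`. -/
structure SemiTambara (T : TambaraSystem G) : Type (u + 1) where
  obj : GSet T.family → Type u
  [semiring : ∀ X, CommSemiring (obj X)]
  res : ∀ {X Y : GSet T.family}, (X ⟶ Y) → (obj Y →+* obj X)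
  add : ∀ {X Y : GSet T.family} (f : X ⟶ Y), T.plus.IsTransfer f → (obj X →+ obj Y)
  mul : ∀ {X Y : GSet T.family} (f : X ⟶ Y), T.mul.IsTransfer f → (obj X →* obj Y)
  /-- `(S^*, S_+)` is a semi-Mackey functor, for the additive monoids -/
  isSemiMackey_add : IsSemiMackey T.plus (fun X => Multiplicative (obj X))
    (fun f => (res f).toAddMonoidHom.toMultiplicative)
    (fun f hf => (add f hf).toMultiplicative)
  /-- `(S^*, S_•)` is a semi-Mackey functor, for the multiplicative monoids -/
  isSemiMackey_mul : IsSemiMackey T.mul obj (fun f => (res f).toMonoidHom) mul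
  /-- compatibility with exponential diagrams (that `η'` and `υ` are transfer morphisms is
  automatic) -/
  exponential : ∀ {X Y Z X' Y' : GSet T.family} (η : X ⟶ Y) (hη : T.mul.IsTransfer η)
    (ξ : Z ⟶ X) (hξ : T.plus.IsTransfer ξ) (ζ : X' ⟶ Z) (η' : X' ⟶ Y')
    (hη' : T.mul.IsTransfer η') (υ : Y' ⟶ Y) (hυ : T.plus.IsTransfer υ),
    T.IsExponential η hη ξ ζ η' υ → ∀ s : obj Z,
      add υ hυ (mul η' hη' (res ζ s)) = mul η hη (add ξ hξ s)

namespace SemiTambara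

variable {T : TambaraSystem G}

instance (S : SemiTambara T) (X : GSet T.family) : CommSemiring (S.obj X) := S.semiring X

/-- A morphism of semi-Tambara functors. -/
@[ext] structure Hom (S S' : SemiTambara T) : Type (u + 1) where
  app : ∀ X : GSet T.family, S.obj X →+* S'.obj X
  res_app : ∀ {X Y : GSet T.family} (f : X ⟶ Y) (s : S.obj Y),
    app X (S.res f s) = S'.res f (app Y s)
  add_app : ∀ {X Y : GSet T.family} (f : X ⟶ Y) (hf : T.plus.IsTransfer f) (s : S.obj X),
    app Y (S.add f hf s) = S'.add f hf (app X s)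
  mul_app : ∀ {X Y : GSet T.family} (f : X ⟶ Y) (hf : T.mul.IsTransfer f) (s : S.obj X),
    app Y (S.mul f hf s) = S'.mul f hf (app X s)

/-- The category of semi-Tambara functors on a Tambara system. -/
instance : Category (SemiTambara T) where
  Hom := Hom
  id S := ⟨fun X => RingHom.id (S.obj X), fun _ _ => rfl, fun _ _ _ => rfl, fun _ _ _ => rfl⟩
  comp φ ψ := ⟨fun X => (ψ.app X).comp (φ.app X),
    fun f s => by simp [φ.res_app, ψ.res_app], fun f hf s => by simp [φ.add_app, ψ.add_app],
    fun f hf s => by simp [φ.mul_app, ψ.mul_app]⟩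

end SemiTambara

/-! ## The category of pairs `(A ⟶ X, m ∈ M(A))` -/

section Over

variable {T : TambaraSystem G}

/-- An object `(p : A ⟶ X, m ∈ M(A))`, where `p` has finite fibres. -/
structure MOver (M : SemiMackey T.mul) (X : GSet T.family) : Type (u + 1) where
  A : GSet T.family
  p : A ⟶ X
  isTransfer : T.plus.IsTransfer p
  m : M.obj A

namespace MOver

variable {M N : SemiMackey T.mul} {X Y : GSet T.family}

/-- A morphism `(p : A ⟶ X, m) ⟶ (q : B ⟶ X, n)` is a map `f : A ⟶ B` over `X` with
`M^*(f)(n) = m`. -/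
@[ext] structure Hom (a b : MOver M X) : Type u where
  f : a.A ⟶ b.A
  w : f ≫ b.p = a.p
  res_m : M.res f b.m = a.m

instance : Category (MOver M X) where
  Hom := Hom
  id a := ⟨𝟙 a.A, Category.id_comp _, M.isSemiMackey.res_id _ _⟩
  comp f g := ⟨f.f ≫ g.f, by rw [Category.assoc, g.w, f.w],
    by rw [M.isSemiMackey.res_comp, g.res_m, f.res_m]⟩

/-- The sum `(A ⨿ B ⟶ X, m ⨿ n)`. -/
noncomputable def sum (a b : MOver M X) : MOver M X where
  A := GSet.sum a.A b.A
  p := sum.desc a.p b.p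
  isTransfer := by
    refine isTransfer_natural (fun x => ?_)
    refine (((a.isTransfer.1 x).image Sum.inl).union
      ((b.isTransfer.1 x).image Sum.inr)).subset ?_
    rintro (z | z) hz
    · exact Or.inl ⟨z, hz, rfl⟩
    · exact Or.inr ⟨z, hz, rfl⟩
  m := M.glue a.m b.m

/-- The product `(A ×_X B ⟶ X, M^*(pr₁)(m) · M^*(pr₂)(n))`. -/
def prod (a b : MOver M X) : MOver M X where
  A := fiberProd a.p b.p
  p := fiberProd.snd a.p b.p ≫ b.p
  isTransfer := (a.isTransfer.snd b.p).comp b.isTransfer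
  m := M.res (fiberProd.fst a.p b.p) a.m * M.res (fiberProd.snd a.p b.p) b.m

/-- `ζ^*(p : A ⟶ X, m) = (A ×_X Y ⟶ Y, M^*(pr₁)(m))`. -/
def res (ζ : Y ⟶ X) (a : MOver M X) : MOver M Y where
  A := fiberProd a.p ζ
  p := fiberProd.snd a.p ζ
  isTransfer := a.isTransfer.snd ζ
  m := M.res (fiberProd.fst a.p ζ) a.m

/-- `ξ_+(p : A ⟶ X, m) = (ξ ∘ p : A ⟶ Y, m)`. -/
def add (ξ : X ⟶ Y) (hξ : T.plus.IsTransfer ξ) (a : MOver M X) : MOver M Y where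
  A := a.A
  p := a.p ≫ ξ
  isTransfer := a.isTransfer.comp hξ
  m := a.m

/-- `η_•(p : A ⟶ X, m) = (π : Π_η(A) ⟶ Y, M_*(ρ)(M^*(λ)(m)))`. -/
def mul (η : X ⟶ Y) (hη : T.mul.IsTransfer η) (a : MOver M X) : MOver M Y where
  A := T.pi η hη a.p
  p := T.piMap η hη a.p
  isTransfer := T.isTransfer_piMap η hη a.p a.isTransfer
  m := M.tr (T.piProj η hη a.p) (T.isTransfer_piProj η hη a.p) (M.res (T.piEval η hη a.p) a.m)

/-- `(p : A ⟶ X, m) ↦ (p : A ⟶ X, φ_A(m))`. -/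
def map (φ : M ⟶ N) (a : MOver M X) : MOver N X where
  A := a.A
  p := a.p
  isTransfer := a.isTransfer
  m := SemiMackey.Hom.app φ a.A a.m

end MOver

/-- The isomorphism classes of pairs `(p : A ⟶ X, m ∈ M(A))`. -/
def IsoClasses (M : SemiMackey T.mul) (X : GSet T.family) : Type (u + 1) :=
  Quotient (isIsomorphicSetoid (MOver M X))

/-- The isomorphism class of a pair. -/
def MOver.cls {M : SemiMackey T.mul} {X : GSet T.family} (a : MOver M X) : IsoClasses M X :=
  Quotient.mk (isIsomorphicSetoid (MOver M X)) a

end Over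

end Tambarization

open Tambarization

/-!
An isomorphism class of pairs `(p : A ⟶ X, m ∈ M(A))` is a "formal sum over the fibres of `p`" of
elements of `M`, and the operations of `𝒮_M` are what sums, restrictions, transfers and products of
such formal sums have to be.  All identities between them come from isomorphisms of `G`-sets
over `X`, together with the check that the elements of `M` on both sides agree.

Each construction is therefore recognized by its universal property in terms of elements, so that
an identity only requires a candidate and the elementwise verification: `MOver.cls_sum_eq`,
`MOver.cls_prod_eq`, `MOver.cls_res_eq` and, for the norm `η_•`, `MOver.cls_mul_eq`.  The last one
says that `(Π_η(A) ⟶ Y, ρ_* λ^* m)` is determined by any diagram `X ← E → C → Y`, `E ⟶ A` in which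
`E = X ×_Y C` and the points of `C` over `y` are the sections of `p` over `η⁻¹(y)`.  For norms, the
equality of elements of `M` follows from the Mackey condition in the form
`SemiMackey.res_tr_piEval`, which computes `Φ^* ρ_* λ^*` for a map `Φ : C ⟶ Π_η(A)`.

The main bijections are: sections of `A ×_X B` are pairs of sections (`MOver.cls_mul_prod`);
sections along a composite are sections of sections (`MOver.cls_mul_comp`); the fibres of a pulled
back map are fibres of the map (`MOver.cls_res_mul`); and a section of `B → Z → X` is a section of
`Z → X` together with a section of `B` along it (`MOver.cls_mul_add`, the distributive law
`η_• ξ_+ = υ_+ η'_• ζ^*`).  Additivity for infinite decompositions `X = ∐ X_l` is gluing of pairs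
(`MOver.sigma`).

The isomorphism classes form a small set because `A` embeds into `X × ℕ` over `X` when `p` has
finite fibres; the values of the semi-Tambara functor are the corresponding small models.
-/

namespace Tambarization

open GSet MackeySystem

variable {G : Type u} [Group G]

/-! ### Equivariant bijections and cartesian squares of `G`-sets -/

namespace GSet

variable {F : SubgroupFamily G}

lemma hom_ext' {X Y : GSet F} {f g : X ⟶ Y} (h : ∀ x, f x = g x) : f = g :=
  ConcreteCategory.hom_ext f g h

/-- An equivariant bijection is an isomorphism. -/
noncomputable def isoOfBijective {X Y : GSet F} (f : X ⟶ Y) (hf : Function.Bijective f) :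
    X ≅ Y where
  hom := f
  inv := mk' (Equiv.ofBijective f hf).symm (by
    intro g y
    apply hf.1
    rw [map_smul']
    exact ((Equiv.ofBijective f hf).apply_symm_apply _).trans
      (congrArg (fun z => g • z) ((Equiv.ofBijective f hf).apply_symm_apply y)).symm)
  hom_inv_id := hom_ext' (fun x => (Equiv.ofBijective f hf).symm_apply_apply x)
  inv_hom_id := hom_ext' (fun y => (Equiv.ofBijective f hf).apply_symm_apply y)

lemma bijective_of_iso {X Y : GSet F} (e : X ≅ Y) : Function.Bijective e.hom :=
  Function.bijective_iff_has_inverse.2 ⟨e.inv,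
    fun x => congrArg (fun f : X ⟶ X => f x) e.hom_inv_id,
    fun y => congrArg (fun f : Y ⟶ Y => f y) e.inv_hom_id⟩

/-- Elementwise form of the statement that the square with `f ∘ g' = g ∘ f'` is cartesian. -/
structure IsCartesian {P A B X : GSet F} (g' : P ⟶ B) (f' : P ⟶ A) (f : B ⟶ X) (g : A ⟶ X) :
    Prop where
  comm : ∀ z, f (g' z) = g (f' z)
  inj : ∀ z w, g' z = g' w → f' z = f' w → z = w
  surj : ∀ b a, f b = g a → ∃ z, g' z = b ∧ f' z = a

lemma IsCartesian.isPullback {P A B X : GSet F} {g' : P ⟶ B} {f' : P ⟶ A} {f : B ⟶ X}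
    {g : A ⟶ X} (h : IsCartesian g' f' f g) : IsPullback g' f' f g := by
  refine ⟨⟨hom_ext' h.comm⟩, ⟨Limits.PullbackCone.IsLimit.mk _ (fun s => ?_) ?_ ?_ ?_⟩⟩
  · have hs : ∀ x, ∃ z, g' z = s.fst x ∧ f' z = s.snd x := fun x =>
      h.surj _ _ (congrArg (fun k : s.pt ⟶ X => k x) s.condition)
    exact mk' (fun x => (hs x).choose) (fun k x => h.inj _ _
      (by rw [(hs (k • x)).choose_spec.1, map_smul', map_smul', (hs x).choose_spec.1])
      (by rw [(hs (k • x)).choose_spec.2, map_smul', map_smul', (hs x).choose_spec.2]))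
  · exact fun s => hom_ext' (fun x => (h.surj (s.fst x) (s.snd x)
      (congrArg (fun k : s.pt ⟶ X => k x) s.condition)).choose_spec.1)
  · exact fun s => hom_ext' (fun x => (h.surj (s.fst x) (s.snd x)
      (congrArg (fun k : s.pt ⟶ X => k x) s.condition)).choose_spec.2)
  · intro s m h1 h2
    refine hom_ext' (fun x => h.inj _ _ ?_ ?_)
    · refine (congrArg (fun k : s.pt ⟶ B => k x) h1).trans (h.surj (s.fst x) (s.snd x)
        (congrArg (fun k : s.pt ⟶ X => k x) s.condition)).choose_spec.1.symm
    · refine (congrArg (fun k : s.pt ⟶ A => k x) h2).trans (h.surj (s.fst x) (s.snd x)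
        (congrArg (fun k : s.pt ⟶ X => k x) s.condition)).choose_spec.2.symm

lemma isCartesian_fiberProd {A B X : GSet F} (p : A ⟶ X) (q : B ⟶ X) :
    IsCartesian (fiberProd.snd p q) (fiberProd.fst p q) q p where
  comm z := z.2.symm
  inj _ _ h h' := Subtype.ext (Prod.ext h' h)
  surj b a h := ⟨⟨(a, b), h.symm⟩, rfl, rfl⟩

/-- A pull-back square is cartesian elementwise, since it is isomorphic to the fibre product. -/
lemma isCartesian_of_isPullback {P A B X : GSet F} {g' : P ⟶ B} {f' : P ⟶ A} {f : B ⟶ X}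
    {g : A ⟶ X} (h : IsPullback g' f' f g) : IsCartesian g' f' f g := by
  have h0 := isCartesian_fiberProd g f
  let e := h.isoIsPullback _ _ h0.isPullback
  have hb := bijective_of_iso e
  have e1 : ∀ z, fiberProd.snd g f (e.hom z) = g' z := fun z =>
    congrArg (fun k : P ⟶ B => k z) (h.isoIsPullback_hom_fst _ _ h0.isPullback)
  have e2 : ∀ z, fiberProd.fst g f (e.hom z) = f' z := fun z =>
    congrArg (fun k : P ⟶ A => k z) (h.isoIsPullback_hom_snd _ _ h0.isPullback)
  refine ⟨fun z => congrArg (fun k : P ⟶ X => k z) h.w, fun z w h1 h2 => ?_, fun b a hba => ?_⟩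
  · exact hb.1 (h0.inj _ _ (by rw [e1, e1, h1]) (by rw [e2, e2, h2]))
  · obtain ⟨y, hy1, hy2⟩ := h0.surj b a hba
    obtain ⟨z, rfl⟩ := hb.2 y
    exact ⟨z, (e1 z).symm.trans hy1, (e2 z).symm.trans hy2⟩

/-- Transfer morphisms are stable under base change along any cartesian square. -/
lemma IsCartesian.isTransfer {S : MackeySystem F} {P A B X : GSet F} {g' : P ⟶ B} {f' : P ⟶ A}
    {f : B ⟶ X} {g : A ⟶ X} (h : IsCartesian g' f' f g) (hg : S.IsTransfer g) :
    S.IsTransfer g' := by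
  refine ⟨fun b => ?_, fun z => ?_⟩
  · refine Set.Finite.of_finite_image (f := f') ((hg.1 (f b)).subset ?_) ?_
    · rintro _ ⟨z, rfl, rfl⟩
      exact (h.comm z).symm
    · intro z hz w hw e
      exact h.inj z w (Eq.trans hz (Eq.symm hw)) e
  · have k := S.inf_mem (X.stab_mem _) (hg.2 (f' z)) (B.stab_mem (g' z))
      (by rw [← h.comm]; exact stabilizer_le f (g' z))
    convert k
    ext t
    rw [Subgroup.mem_inf, MulAction.mem_stabilizer_iff, MulAction.mem_stabilizer_iff,
      MulAction.mem_stabilizer_iff]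
    constructor
    · intro e
      exact ⟨by rw [← map_smul', e], by rw [← map_smul', e]⟩
    · rintro ⟨e1, e2⟩
      exact h.inj _ _ (by rw [map_smul', e2]) (by rw [map_smul', e1])

end GSet

lemma PiSet.sec_congr_left {F : SubgroupFamily G} {X Y A : GSet F} {η : X ⟶ Y} {p : A ⟶ X}
    {s t : PiSet η p} (e : s = t) {x x' : X} (ex : x = x') (h : η x = s.base)
    (h' : η x' = t.base) : s.sec x h = t.sec x' h' := by
  subst e ex
  rfl

/-! ### Restriction, gluing and transfer in a semi-Mackey functor -/

namespace SemiMackey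

variable {F : SubgroupFamily G} {S : MackeySystem F} (M : SemiMackey S)

lemma res_res {X Y Z : GSet F} (f : X ⟶ Y) (g : Y ⟶ Z) (m : M.obj Z) :
    M.res f (M.res g m) = M.res (f ≫ g) m := (M.isSemiMackey.res_comp f g m).symm

lemma res_congr {X Y : GSet F} {f g : X ⟶ Y} (h : ∀ x, f x = g x) (m : M.obj Y) :
    M.res f m = M.res g m := by rw [hom_ext' h]

lemma res_trans {X Y Z : GSet F} {f : X ⟶ Y} {g : Y ⟶ Z} {h : X ⟶ Z} (e : ∀ x, h x = g (f x))
    {m : M.obj Z} {n : M.obj Y} (hm : M.res g m = n) : M.res h m = M.res f n := by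
  subst hm
  exact (M.res_congr e m).trans (M.isSemiMackey.res_comp f g m)

lemma res_eq_self {X : GSet F} {f : X ⟶ X} (h : ∀ x, f x = x) (m : M.obj X) :
    M.res f m = m := by
  rw [M.res_congr (g := 𝟙 X) h]
  exact M.isSemiMackey.res_id X m

lemma res_tr {P A B X : GSet F} {g' : P ⟶ B} {f' : P ⟶ A} {f : B ⟶ X} {g : A ⟶ X}
    (h : IsCartesian g' f' f g) (hg : S.IsTransfer g) (m : M.obj A) :
    M.res f (M.tr g hg m) = M.tr g' (h.isTransfer hg) (M.res f' m) :=
  M.isSemiMackey.mackey h.isPullback hg _ m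

/-- An element is determined by its restrictions to the members of a decomposition. -/
lemma ext_decomposition {L : Type u} {X : GSet F} {X' : L → GSet F} {i : ∀ l, X' l ⟶ X}
    (hi : IsDecomposition i) {m n : M.obj X} (h : ∀ l, M.res (i l) m = M.res (i l) n) : m = n :=
  (M.isSemiMackey.additive i hi).1 (funext h)

lemma ext_sum {A B : GSet F} {m n : M.obj (GSet.sum A B)}
    (h1 : M.res (sum.inl A B) m = M.res (sum.inl A B) n)
    (h2 : M.res (sum.inr A B) m = M.res (sum.inr A B) n) : m = n := by
  let X' : ULift.{u} Bool → GSet F := fun l => Bool.rec A B l.down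
  let i : ∀ l, X' l ⟶ GSet.sum A B := fun l => match l with
    | ⟨false⟩ => sum.inl A B
    | ⟨true⟩ => sum.inr A B
  have hi : IsDecomposition i := by
    constructor
    · rintro ⟨⟨_ | _⟩, x⟩ ⟨⟨_ | _⟩, y⟩ h
      · cases (show (Sum.inl x : A ⊕ B) = Sum.inl y from h)
        rfl
      · cases (show (Sum.inl x : A ⊕ B) = Sum.inr y from h)
      · cases (show (Sum.inr x : A ⊕ B) = Sum.inl y from h)
      · cases (show (Sum.inr x : A ⊕ B) = Sum.inr y from h)
        rfl
    · rintro (x | x)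
      · exact ⟨⟨⟨false⟩, x⟩, rfl⟩
      · exact ⟨⟨⟨true⟩, x⟩, rfl⟩
  refine M.ext_decomposition hi ?_
  rintro ⟨_ | _⟩
  · exact h1
  · exact h2

lemma res_inl_glue {A B : GSet F} (a : M.obj A) (b : M.obj B) :
    M.res (sum.inl A B) (M.glue a b) = a := (M.exists_glue a b).choose_spec.1

lemma res_inr_glue {A B : GSet F} (a : M.obj A) (b : M.obj B) :
    M.res (sum.inr A B) (M.glue a b) = b := (M.exists_glue a b).choose_spec.2

/-- `M(∅)` is trivial, by additivity for the empty decomposition. -/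
lemma eq_of_isEmpty {A : GSet F} (h : A → False) (m n : M.obj A) : m = n :=
  M.ext_decomposition (L := PEmpty) (X' := fun l => l.elim) (i := fun l => l.elim)
    ⟨fun z => z.1.elim, fun x => (h x).elim⟩ (fun l => l.elim)

end SemiMackey

/-- Restriction of the multiplicative norm data along `Φ : C ⟶ Π_η(A)`: if `E` is the fibre
product of `X` and `C` over `Y` and `l : E ⟶ A` evaluates the sections given by `Φ`, then
`Φ^* ρ_* λ^*` is the transfer along `E ⟶ C` after restriction along `l`. -/
lemma SemiMackey.res_tr_piEval {T : TambaraSystem G} (M : SemiMackey T.mul)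
    {X Y A C E : GSet T.family} {η : X ⟶ Y} (hη : T.mul.IsTransfer η) {p : A ⟶ X}
    (Φ : C ⟶ T.pi η hη p) {ε : E ⟶ X} {ρ : E ⟶ C} (hρ : T.mul.IsTransfer ρ) {l : E ⟶ A}
    {q : C ⟶ Y} (hq : ∀ c, PiSet.base (Φ c) = q c) (h : IsCartesian ρ ε q η)
    (hl : ∀ e h', PiSet.sec (Φ (ρ e)) (ε e) h' = l e) (m : M.obj A) :
    M.res Φ (M.tr (T.piProj η hη p) (T.isTransfer_piProj η hη p) (M.res (T.piEval η hη p) m))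
      = M.tr ρ hρ (M.res l m) := by
  let k : E ⟶ fiberProd η (T.piMap η hη p) :=
    mk' (Y := fiberProd η (T.piMap η hη p))
      (fun e => ⟨(ε e, Φ (ρ e)), (h.comm e).symm.trans (hq (ρ e)).symm⟩)
      (fun g e => Subtype.ext (Prod.ext (map_smul' ε g e)
        ((congrArg Φ (map_smul' ρ g e)).trans (map_smul' Φ g (ρ e)))))
  have c : IsCartesian ρ k Φ (T.piProj η hη p) := by
    refine ⟨fun _ => rfl, fun z w h1 h2 => h.inj z w h1
      (congrArg (fun t : fiberProd η (T.piMap η hη p) => t.1.1) h2), ?_⟩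
    rintro b ⟨⟨x, s⟩, hs⟩ hb
    have hb' : Φ b = s := hb
    obtain ⟨e, rfl, rfl⟩ := h.surj b x
      ((hq b).symm.trans ((congrArg PiSet.base hb').trans (Eq.symm hs)))
    exact ⟨e, rfl, Subtype.ext (Prod.ext rfl hb')⟩
  rw [M.res_tr c, M.res_res]
  congr 1
  exact M.res_congr (fun e => hl e _) m

variable {T : TambaraSystem G}

/-! ### Recognizing isomorphism classes of pairs -/

namespace MOver

variable {M : SemiMackey T.mul} {X Y : GSet T.family}

lemma cls_eq_cls_iff {a b : MOver M X} : a.cls = b.cls ↔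
    ∃ f : a.A ≅ b.A, (∀ x, b.p (f.hom x) = a.p x) ∧ M.res f.hom b.m = a.m := by
  refine Quotient.eq.trans ⟨?_, ?_⟩
  · rintro ⟨e⟩
    exact ⟨⟨e.hom.f, e.inv.f, congrArg Hom.f e.hom_inv_id, congrArg Hom.f e.inv_hom_id⟩,
      fun x => congrArg (fun k : a.A ⟶ X => k x) e.hom.w, e.hom.res_m⟩
  · rintro ⟨e, hp, hm⟩
    refine ⟨⟨⟨e.hom, hom_ext' hp, hm⟩, ⟨e.inv, ?_, ?_⟩, Hom.ext e.hom_inv_id,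
      Hom.ext e.inv_hom_id⟩⟩
    · rw [Iso.inv_comp_eq]
      exact (hom_ext' hp).symm
    · rw [← hm, M.res_res, e.inv_hom_id, M.isSemiMackey.res_id]

lemma cls_eq_of_bijective {a b : MOver M X} (f : a.A ⟶ b.A) (hf : Function.Bijective f)
    (hp : ∀ x, b.p (f x) = a.p x) (hm : M.res f b.m = a.m) : a.cls = b.cls :=
  cls_eq_cls_iff.2 ⟨isoOfBijective f hf, hp, hm⟩

/-- Recognition of the sum: `c` is covered disjointly by `a` and `b`. -/
lemma cls_sum_eq {a b c : MOver M X} (i : a.A ⟶ c.A) (j : b.A ⟶ c.A)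
    (hi : Function.Injective i) (hj : Function.Injective j) (hij : ∀ x y, i x ≠ j y)
    (hc : ∀ z, (∃ x, i x = z) ∨ ∃ y, j y = z)
    (pi : ∀ x, c.p (i x) = a.p x) (pj : ∀ y, c.p (j y) = b.p y)
    (mi : M.res i c.m = a.m) (mj : M.res j c.m = b.m) : (a.sum b).cls = c.cls := by
  refine cls_eq_of_bijective (a := a.sum b) (sum.desc i j) ⟨?_, ?_⟩ ?_ ?_
  · rintro (x | x) (y | y) h
    · exact congrArg Sum.inl (hi h)
    · exact (hij x y h).elim
    · exact (hij y x (Eq.symm h)).elim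
    · exact congrArg Sum.inr (hj h)
  · intro z
    rcases hc z with ⟨x, rfl⟩ | ⟨y, rfl⟩
    · exact ⟨Sum.inl x, rfl⟩
    · exact ⟨Sum.inr y, rfl⟩
  · rintro (x | y)
    · exact pi x
    · exact pj y
  · refine M.ext_sum ?_ ?_
    · refine (M.res_res _ _ _).trans (Eq.trans ?_ (M.res_inl_glue a.m b.m).symm)
      exact (M.res_congr (fun _ => rfl) _).trans mi
    · refine (M.res_res _ _ _).trans (Eq.trans ?_ (M.res_inr_glue a.m b.m).symm)
      exact (M.res_congr (fun _ => rfl) _).trans mj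

/-- Recognition of the product. -/
lemma cls_prod_eq {a b c : MOver M X} (u : c.A ⟶ a.A) (v : c.A ⟶ b.A)
    (h : IsCartesian v u b.p a.p) (hv : ∀ x, b.p (v x) = c.p x)
    (hm : c.m = M.res u a.m * M.res v b.m) : (a.prod b).cls = c.cls := by
  refine (cls_eq_of_bijective (b := a.prod b) (mk' (Y := fiberProd a.p b.p)
    (fun z => ⟨(u z, v z), (h.comm z).symm⟩)
    (fun g z => Subtype.ext (Prod.ext (map_smul' u g z) (map_smul' v g z)))) ⟨?_, ?_⟩ hv ?_).symm
  · intro z w e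
    exact h.inj z w (congrArg (fun t : fiberProd a.p b.p => t.1.2) e)
      (congrArg (fun t : fiberProd a.p b.p => t.1.1) e)
  · rintro ⟨⟨x, y⟩, e⟩
    obtain ⟨z, rfl, rfl⟩ := h.surj y x (Eq.symm e)
    exact ⟨z, rfl⟩
  · exact (map_mul (M.res _) _ _).trans ((congrArg₂ (· * ·)
      (M.res_trans (fun _ => rfl) rfl).symm (M.res_trans (fun _ => rfl) rfl).symm).trans hm.symm)

/-- Recognition of the restriction. -/
lemma cls_res_eq {ζ : Y ⟶ X} {a : MOver M X} {c : MOver M Y} (u : c.A ⟶ a.A)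
    (h : IsCartesian c.p u ζ a.p) (hm : M.res u a.m = c.m) : (a.res ζ).cls = c.cls := by
  refine (cls_eq_of_bijective (b := a.res ζ) (mk' (Y := fiberProd a.p ζ)
    (fun z => ⟨(u z, c.p z), (h.comm z).symm⟩)
    (fun g z => Subtype.ext (Prod.ext (map_smul' u g z) (map_smul' c.p g z)))) ⟨?_, ?_⟩
    (fun _ => rfl) ?_).symm
  · intro z w e
    exact h.inj z w (congrArg (fun t : fiberProd a.p ζ => t.1.2) e)
      (congrArg (fun t : fiberProd a.p ζ => t.1.1) e)
  · rintro ⟨⟨x, y⟩, e⟩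
    obtain ⟨z, rfl, rfl⟩ := h.surj y x (Eq.symm e)
    exact ⟨z, rfl⟩
  · rw [← hm]
    exact M.res_res _ _ _

/-- Recognition of the multiplicative norm.  The hypotheses say that
`X ← a.A ← E → c.A → Y` is an exponential diagram, in terms of elements: `E` is the fibre product
of `X` and `c.A` over `Y`, and the points of `c.A` over `y` correspond, via `l`, to the sections of
`a.p` over `η⁻¹(y)`. -/
lemma cls_mul_eq {η : X ⟶ Y} {hη : T.mul.IsTransfer η} {a : MOver M X} {c : MOver M Y}
    {E : GSet T.family} {ε : E ⟶ X} {ρ : E ⟶ c.A} (l : E ⟶ a.A)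
    (h : IsCartesian ρ ε c.p η) (hl : ∀ e, a.p (l e) = ε e)
    (inj : ∀ z w, c.p z = c.p w →
      (∀ d e, ρ d = z → ρ e = w → ε d = ε e → l d = l e) → z = w)
    (surj : ∀ s : PiSet η a.p, ∃ z, c.p z = s.base ∧
      ∀ e, ρ e = z → ∀ h', l e = s.sec (ε e) h')
    (hm : c.m = M.tr ρ (h.isTransfer hη) (M.res l a.m)) : (a.mul η hη).cls = c.cls := by
  -- `e z x` is the point of `E` lying over `x` and `z`
  let e : ∀ z x, η x = c.p z → E := fun z x hx => (h.surj z x hx.symm).choose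
  have e1 : ∀ z x hx, ρ (e z x hx) = z := fun z x hx => (h.surj z x hx.symm).choose_spec.1
  have e2 : ∀ z x hx, ε (e z x hx) = x := fun z x hx => (h.surj z x hx.symm).choose_spec.2
  let Φ : c.A ⟶ T.pi η hη a.p := mk' (Y := T.pi η hη a.p)
    (fun z => (⟨c.p z, fun x hx => l (e z x hx),
      fun x hx => (hl _).trans (e2 z x hx)⟩ : PiSet η a.p))
    (fun g z => PiSet.ext' (map_smul' c.p g z) (fun x hx hx' => by
      have hx₀ : η (g⁻¹ • x) = c.p z := PiSet.inv_smul_mem hx'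
      refine Eq.trans ?_ (map_smul' l g (e z (g⁻¹ • x) hx₀))
      refine congrArg l (h.inj _ _ ((e1 (g • z) x hx).trans ?_) ((e2 (g • z) x hx).trans ?_))
      · exact (congrArg (fun w => g • w) (e1 z _ hx₀)).symm.trans (map_smul' ρ g _).symm
      · refine Eq.trans ?_ (map_smul' ε g _).symm
        exact (smul_inv_smul g x).symm.trans (congrArg (fun w => g • w) (e2 z _ hx₀).symm)))
  have hs : ∀ d h', PiSet.sec (Φ (ρ d)) (ε d) h' = l d := fun d h' =>
    congrArg l (h.inj _ _ (e1 _ _ h') (e2 _ _ h'))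
  refine (cls_eq_of_bijective (b := a.mul η hη) Φ ⟨?_, ?_⟩ (fun _ => rfl) ?_).symm
  · intro z w hzw
    refine inj z w (congrArg PiSet.base hzw) ?_
    rintro d d' rfl rfl hd
    rw [← hs d (h.comm d).symm, ← hs d' (h.comm d').symm]
    exact PiSet.sec_congr_left hzw hd _ _
  · intro s
    obtain ⟨z, hz, hz'⟩ := surj s
    refine ⟨z, PiSet.ext' hz (fun x hx hx' => ?_)⟩
    have := hz' (e z x hx) (e1 z x hx) ((congrArg η (e2 z x hx)).trans hx')
    exact this.trans (PiSet.sec_congr_left rfl (e2 z x hx) _ _)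
  · rw [hm]
    exact M.res_tr_piEval hη Φ (h.isTransfer hη) (fun _ => rfl) h hs a.m

/-! ### Sums, products and the distributive law on isomorphism classes -/

/-- The pair `(∅ ⟶ X, 1)`. -/
def zero (M : SemiMackey T.mul) (X : GSet T.family) : MOver M X where
  A := { carrier := PEmpty
         action :=
          { smul := fun _ x => x
            one_smul := fun x => x.elim
            mul_smul := fun _ _ x => x.elim }
         stab_mem := fun x => x.elim }
  p := mk' (fun x => PEmpty.elim x) (fun _ x => PEmpty.elim x)
  isTransfer := ⟨fun _ => Set.Subsingleton.finite (fun x => PEmpty.elim x),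
    fun x => PEmpty.elim x⟩
  m := 1

/-- The pair `(id : X ⟶ X, 1)`. -/
def one (M : SemiMackey T.mul) (X : GSet T.family) : MOver M X where
  A := X
  p := 𝟙 X
  isTransfer := isTransfer_natural (fun _ => Set.Subsingleton.finite (fun _ hx _ hx' =>
    Eq.trans hx (Eq.symm hx')))
  m := 1

lemma zero_elim (x : (zero M X).A) : False := PEmpty.elim x

lemma cls_sum_congr {a a' b b' : MOver M X} (h : a.cls = a'.cls) (h' : b.cls = b'.cls) :
    (a.sum b).cls = (a'.sum b').cls := by
  obtain ⟨f, hf, mf⟩ := cls_eq_cls_iff.1 h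
  obtain ⟨k, hk, mk⟩ := cls_eq_cls_iff.1 h'
  have bf := bijective_of_iso f
  have bk := bijective_of_iso k
  refine cls_sum_eq (c := a'.sum b') (f.hom ≫ sum.inl _ _) (k.hom ≫ sum.inr _ _)
    (Sum.inl_injective.comp bf.1) (Sum.inr_injective.comp bk.1) (fun _ _ => Sum.inl_ne_inr) ?_
    hf hk ?_ ?_
  · rintro (x | x)
    · obtain ⟨y, rfl⟩ := bf.2 x
      exact Or.inl ⟨y, rfl⟩
    · obtain ⟨y, rfl⟩ := bk.2 x
      exact Or.inr ⟨y, rfl⟩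
  · exact (M.res_trans (fun _ => rfl) (M.res_inl_glue _ _)).trans mf
  · exact (M.res_trans (fun _ => rfl) (M.res_inr_glue _ _)).trans mk

lemma cls_sum_comm (a b : MOver M X) : (a.sum b).cls = (b.sum a).cls := by
  refine cls_sum_eq (c := b.sum a) (sum.inr _ _) (sum.inl _ _) Sum.inr_injective
    Sum.inl_injective (fun _ _ => Sum.inr_ne_inl) ?_ (fun _ => rfl) (fun _ => rfl)
    (M.res_inr_glue _ _) (M.res_inl_glue _ _)
  rintro (x | x)
  · exact Or.inr ⟨x, rfl⟩
  · exact Or.inl ⟨x, rfl⟩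

lemma cls_zero_sum (a : MOver M X) : ((zero M X).sum a).cls = a.cls := by
  refine cls_sum_eq (mk' (fun x => PEmpty.elim x) (fun _ x => PEmpty.elim x)) (𝟙 _)
    (fun x => PEmpty.elim x) Function.injective_id (fun x => PEmpty.elim x)
    (fun z => Or.inr ⟨z, rfl⟩) (fun x => PEmpty.elim x) (fun _ => rfl)
    (M.eq_of_isEmpty zero_elim _ _) (M.res_eq_self (fun _ => rfl) _)

lemma cls_sum_assoc (a b c : MOver M X) :
    ((a.sum b).sum c).cls = (a.sum (b.sum c)).cls := by
  refine cls_sum_eq (a := a.sum b) (c := a.sum (b.sum c))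
    (sum.desc (sum.inl _ _) (sum.inl b.A c.A ≫ sum.inr a.A (GSet.sum b.A c.A)))
    (sum.inr b.A c.A ≫ sum.inr a.A (GSet.sum b.A c.A)) ?_ ?_ ?_ ?_ ?_ (fun _ => rfl) ?_ ?_
  · rintro (x | x) (y | y) h
    · exact congrArg Sum.inl (Sum.inl_injective h)
    · exact (Sum.inl_ne_inr h).elim
    · exact (Sum.inr_ne_inl h).elim
    · exact congrArg Sum.inr (Sum.inl_injective (Sum.inr_injective h))
  · exact Sum.inr_injective.comp Sum.inr_injective
  · rintro (x | x) y h
    · exact Sum.inl_ne_inr h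
    · exact Sum.inl_ne_inr (Sum.inr_injective h)
  · rintro (x | x | x)
    · exact Or.inl ⟨Sum.inl x, rfl⟩
    · exact Or.inl ⟨Sum.inr x, rfl⟩
    · exact Or.inr ⟨x, rfl⟩
  · rintro (x | x)
    · rfl
    · rfl
  · refine M.ext_sum ?_ ?_
    · refine (M.res_res _ _ _).trans (Eq.trans ?_ (M.res_inl_glue a.m b.m).symm)
      exact (M.res_congr (fun _ => rfl) _).trans (M.res_inl_glue a.m (M.glue b.m c.m))
    · refine (M.res_res _ _ _).trans (Eq.trans ?_ (M.res_inr_glue a.m b.m).symm)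
      exact (M.res_trans (fun _ => rfl) (M.res_inr_glue a.m (M.glue b.m c.m))).trans
        (M.res_inl_glue _ _)
  · exact (M.res_trans (fun _ => rfl) (M.res_inr_glue a.m (M.glue b.m c.m))).trans
      (M.res_inr_glue _ _)

lemma cls_prod_congr {a a' b b' : MOver M X} (h : a.cls = a'.cls) (h' : b.cls = b'.cls) :
    (a.prod b).cls = (a'.prod b').cls := by
  obtain ⟨f, hf, mf⟩ := cls_eq_cls_iff.1 h
  obtain ⟨k, hk, mk⟩ := cls_eq_cls_iff.1 h'
  have bf := bijective_of_iso f
  have bk := bijective_of_iso k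
  refine (cls_prod_eq (c := a.prod b) (fiberProd.fst _ _ ≫ f.hom) (fiberProd.snd _ _ ≫ k.hom)
    ⟨?_, ?_, ?_⟩ (fun z => hk _) ?_).symm
  · exact fun z => (hk z.1.2).trans (Eq.trans (Eq.symm z.2) (hf z.1.1).symm)
  · exact fun z w h1 h2 => Subtype.ext (Prod.ext (bf.1 h2) (bk.1 h1))
  · intro y x hxy
    obtain ⟨x, rfl⟩ := bf.2 x
    obtain ⟨y, rfl⟩ := bk.2 y
    exact ⟨⟨(x, y), ((hf x).symm.trans hxy.symm).trans (hk y)⟩, rfl, rfl⟩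
  · exact congrArg₂ (· * ·) (M.res_trans (fun _ => rfl) mf).symm
      (M.res_trans (fun _ => rfl) mk).symm

lemma cls_prod_comm (a b : MOver M X) : (a.prod b).cls = (b.prod a).cls := by
  refine cls_prod_eq (c := b.prod a) (fiberProd.snd _ _) (fiberProd.fst _ _) ⟨?_, ?_, ?_⟩
    (fun z => z.2) (mul_comm _ _)
  · exact fun z => z.2
  · exact fun z w h1 h2 => Subtype.ext (Prod.ext h1 h2)
  · exact fun y x hxy => ⟨⟨(y, x), hxy⟩, rfl, rfl⟩

lemma cls_one_prod (a : MOver M X) : ((one M X).prod a).cls = a.cls := by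
  refine cls_prod_eq (a := one M X) (a.p : a.A ⟶ X) (𝟙 _) ⟨fun _ => rfl, fun z w h _ => h, ?_⟩
    (fun _ => rfl) ?_
  · exact fun y x hxy => ⟨y, rfl, hxy⟩
  · exact (one_mul a.m).symm.trans (congrArg₂ (· * ·) (map_one (M.res a.p)).symm
      (M.res_eq_self (fun _ => rfl) _).symm)

lemma cls_prod_assoc (a b c : MOver M X) :
    ((a.prod b).prod c).cls = (a.prod (b.prod c)).cls := by
  refine cls_prod_eq (a := a.prod b) (c := a.prod (b.prod c))
    (mk' (X := (a.prod (b.prod c)).A) (Y := (a.prod b).A)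
      (fun z => ⟨(z.1.1, z.1.2.1.1), Eq.trans z.2 (Eq.symm z.1.2.2)⟩) (fun _ _ => rfl))
    (mk' (X := (a.prod (b.prod c)).A) (fun z => z.1.2.1.2) (fun _ _ => rfl)) ⟨?_, ?_, ?_⟩
    (fun _ => rfl) ?_
  · exact fun z => Eq.symm z.1.2.2
  · rintro ⟨⟨x, ⟨⟨y, z⟩, h⟩⟩, h'⟩ ⟨⟨x', ⟨⟨y', z'⟩, k⟩⟩, k'⟩ h1 h2
    obtain rfl : z = z' := h1
    obtain ⟨rfl, rfl⟩ := Prod.ext_iff.1 (Subtype.ext_iff.1 h2)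
    rfl
  · rintro z ⟨⟨x, y⟩, h⟩ h'
    exact ⟨⟨(x, ⟨(y, z), Eq.symm h'⟩), Eq.trans h (Eq.symm h')⟩, rfl, rfl⟩
  · refine (congrArg (fun t => _ * t) (map_mul (M.res _) _ _)).trans
      ((mul_assoc _ _ _).symm.trans ?_)
    refine congrArg₂ (· * ·) (Eq.trans ?_ (map_mul (M.res _) _ _).symm)
      (M.res_trans (fun _ => rfl) rfl).symm
    exact congrArg₂ (· * ·) (M.res_trans (fun _ => rfl) rfl)
      ((M.res_res _ _ _).trans (M.res_trans (fun _ => rfl) rfl))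

lemma cls_zero_prod (a : MOver M X) : ((zero M X).prod a).cls = (zero M X).cls := by
  refine cls_prod_eq (a := zero M X) (𝟙 (zero M X).A)
    (mk' (fun x => PEmpty.elim x) (fun _ x => PEmpty.elim x))
    ⟨fun x => PEmpty.elim x, fun x => PEmpty.elim x, fun _ x => PEmpty.elim x⟩
    (fun x => PEmpty.elim x) (M.eq_of_isEmpty zero_elim _ _)

lemma cls_sum_prod (a b c : MOver M X) :
    ((a.sum b).prod c).cls = ((a.prod c).sum (b.prod c)).cls := by
  refine (cls_sum_eq (a := a.prod c) (b := b.prod c) (c := (a.sum b).prod c)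
    (mk' (X := (a.prod c).A) (Y := ((a.sum b).prod c).A)
      (fun z => ⟨(Sum.inl z.1.1, z.1.2), z.2⟩) (fun _ _ => rfl))
    (mk' (X := (b.prod c).A) (Y := ((a.sum b).prod c).A)
      (fun z => ⟨(Sum.inr z.1.1, z.1.2), z.2⟩) (fun _ _ => rfl))
    ?_ ?_ ?_ ?_ (fun _ => rfl) (fun _ => rfl) ?_ ?_).symm
  · intro z w h
    have h' := Prod.ext_iff.1 (Subtype.ext_iff.1 h)
    exact Subtype.ext (Prod.ext (Sum.inl_injective h'.1) h'.2)
  · intro z w h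
    have h' := Prod.ext_iff.1 (Subtype.ext_iff.1 h)
    exact Subtype.ext (Prod.ext (Sum.inr_injective h'.1) h'.2)
  · intro z w h
    exact Sum.inl_ne_inr (Prod.ext_iff.1 (Subtype.ext_iff.1 h)).1
  · rintro ⟨⟨x | x, y⟩, h⟩
    · exact Or.inl ⟨⟨(x, y), h⟩, rfl⟩
    · exact Or.inr ⟨⟨(x, y), h⟩, rfl⟩
  · refine (map_mul (M.res _) _ _).trans (congrArg₂ (· * ·) ?_ (M.res_res _ _ _))
    exact (M.res_res _ _ _).trans (M.res_trans (fun _ => rfl) (M.res_inl_glue a.m b.m))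
  · refine (map_mul (M.res _) _ _).trans (congrArg₂ (· * ·) ?_ (M.res_res _ _ _))
    exact (M.res_res _ _ _).trans (M.res_trans (fun _ => rfl) (M.res_inr_glue a.m b.m))

end MOver

namespace MOver

variable {M N : SemiMackey T.mul} {X Y Z : GSet T.family}

/-! ### Restrictions -/

lemma cls_res_congr (ζ : Y ⟶ X) {a a' : MOver M X} (h : a.cls = a'.cls) :
    (a.res ζ).cls = (a'.res ζ).cls := by
  obtain ⟨f, hf, mf⟩ := cls_eq_cls_iff.1 h
  have bf := bijective_of_iso f
  refine (cls_res_eq (c := a.res ζ) (fiberProd.fst a.p ζ ≫ f.hom) ⟨?_, ?_, ?_⟩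
    (M.res_trans (fun _ => rfl) mf)).symm
  · exact fun z => Eq.trans (Eq.symm z.2) (hf z.1.1).symm
  · exact fun z w h1 h2 => Subtype.ext (Prod.ext (bf.1 h2) h1)
  · intro y x hxy
    obtain ⟨x, rfl⟩ := bf.2 x
    exact ⟨⟨(x, y), (hf x).symm.trans hxy.symm⟩, rfl, rfl⟩

lemma cls_res_id (a : MOver M X) : (a.res (𝟙 X)).cls = a.cls :=
  cls_res_eq (𝟙 a.A) ⟨fun _ => rfl, fun _ _ _ h => h, fun _ x h => ⟨x, Eq.symm h, rfl⟩⟩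
    (M.res_eq_self (fun _ => rfl) _)

lemma cls_res_comp (f : X ⟶ Y) (g : Y ⟶ Z) (a : MOver M Z) :
    (a.res (f ≫ g)).cls = ((a.res g).res f).cls := by
  refine cls_res_eq (c := (a.res g).res f)
    (fiberProd.fst (a.res g).p f ≫ fiberProd.fst a.p g) ⟨?_, ?_, ?_⟩
    (M.res_trans (fun _ => rfl) rfl)
  · rintro ⟨⟨⟨⟨x, y⟩, h⟩, z⟩, h'⟩
    exact (congrArg g (Eq.symm h')).trans (Eq.symm h)
  · rintro ⟨⟨⟨⟨x, y⟩, h⟩, z⟩, h'⟩ ⟨⟨⟨⟨x', y'⟩, k⟩, z'⟩, k'⟩ h1 h2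
    obtain rfl : z = z' := h1
    obtain rfl : x = x' := h2
    obtain rfl : y = y' := Eq.trans h' (Eq.symm k')
    rfl
  · exact fun z x h => ⟨⟨(⟨(x, f z), Eq.symm h⟩, z), rfl⟩, rfl, rfl⟩

lemma cls_res_zero (ζ : Y ⟶ X) : ((zero M X).res ζ).cls = (zero M Y).cls := by
  refine cls_res_eq (a := zero M X) (c := zero M Y) (𝟙 (zero M X).A)
    ⟨fun x => PEmpty.elim x, fun x => PEmpty.elim x, fun _ x => PEmpty.elim x⟩
    (M.eq_of_isEmpty zero_elim _ _)

lemma cls_res_one (ζ : Y ⟶ X) : ((one M X).res ζ).cls = (one M Y).cls :=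
  cls_res_eq (a := one M X) (c := one M Y) ζ
    ⟨fun _ => rfl, fun _ _ h _ => h, fun y _ h => ⟨y, rfl, h⟩⟩ (map_one _)

lemma cls_res_sum (ζ : Y ⟶ X) (a b : MOver M X) :
    ((a.sum b).res ζ).cls = ((a.res ζ).sum (b.res ζ)).cls := by
  refine (cls_sum_eq (a := a.res ζ) (b := b.res ζ) (c := (a.sum b).res ζ)
    (mk' (X := (a.res ζ).A) (Y := ((a.sum b).res ζ).A)
      (fun z => ⟨(Sum.inl z.1.1, z.1.2), z.2⟩) (fun _ _ => rfl))
    (mk' (X := (b.res ζ).A) (Y := ((a.sum b).res ζ).A)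
      (fun z => ⟨(Sum.inr z.1.1, z.1.2), z.2⟩) (fun _ _ => rfl))
    ?_ ?_ ?_ ?_ (fun _ => rfl) (fun _ => rfl) ?_ ?_).symm
  · intro z w h
    have h' := Prod.ext_iff.1 (Subtype.ext_iff.1 h)
    exact Subtype.ext (Prod.ext (Sum.inl_injective h'.1) h'.2)
  · intro z w h
    have h' := Prod.ext_iff.1 (Subtype.ext_iff.1 h)
    exact Subtype.ext (Prod.ext (Sum.inr_injective h'.1) h'.2)
  · intro z w h
    exact Sum.inl_ne_inr (Prod.ext_iff.1 (Subtype.ext_iff.1 h)).1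
  · rintro ⟨⟨x | x, y⟩, h⟩
    · exact Or.inl ⟨⟨(x, y), h⟩, rfl⟩
    · exact Or.inr ⟨⟨(x, y), h⟩, rfl⟩
  · exact (M.res_res _ _ _).trans (M.res_trans (fun _ => rfl) (M.res_inl_glue a.m b.m))
  · exact (M.res_res _ _ _).trans (M.res_trans (fun _ => rfl) (M.res_inr_glue a.m b.m))

lemma cls_res_prod (ζ : Y ⟶ X) (a b : MOver M X) :
    ((a.prod b).res ζ).cls = ((a.res ζ).prod (b.res ζ)).cls := by
  refine (cls_prod_eq (a := a.res ζ) (b := b.res ζ) (c := (a.prod b).res ζ)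
    (mk' (X := ((a.prod b).res ζ).A) (Y := (a.res ζ).A)
      (fun z => ⟨(z.1.1.1.1, z.1.2), Eq.trans z.1.1.2 z.2⟩) (fun _ _ => rfl))
    (mk' (X := ((a.prod b).res ζ).A) (Y := (b.res ζ).A)
      (fun z => ⟨(z.1.1.1.2, z.1.2), z.2⟩) (fun _ _ => rfl))
    ⟨fun _ => rfl, ?_, ?_⟩ (fun _ => rfl) ?_).symm
  · intro z w h1 h2
    have h1' := Prod.ext_iff.1 (Subtype.ext_iff.1 h1)
    have h2' := Prod.ext_iff.1 (Subtype.ext_iff.1 h2)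
    exact Subtype.ext (Prod.ext (Subtype.ext (Prod.ext h2'.1 h1'.1)) h1'.2)
  · rintro ⟨⟨y, t⟩, h⟩ ⟨⟨x, t'⟩, h'⟩ e
    obtain rfl : t = t' := e
    exact ⟨⟨(⟨(x, y), Eq.trans h' (Eq.symm h)⟩, t), h⟩, rfl, rfl⟩
  · refine (map_mul (M.res _) _ _).trans (congrArg₂ (· * ·) ?_ ?_)
    · exact (M.res_res _ _ _).trans (M.res_trans (fun _ => rfl) rfl)
    · exact (M.res_res _ _ _).trans (M.res_trans (fun _ => rfl) rfl)

/-! ### Additive transfers -/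

lemma cls_add_congr (ξ : X ⟶ Y) (hξ : T.plus.IsTransfer ξ) {a a' : MOver M X}
    (h : a.cls = a'.cls) : (a.add ξ hξ).cls = (a'.add ξ hξ).cls := by
  obtain ⟨f, hf, mf⟩ := cls_eq_cls_iff.1 h
  exact cls_eq_cls_iff.2 ⟨f, fun x => congrArg ξ (hf x), mf⟩

lemma cls_add_zero (ξ : X ⟶ Y) (hξ : T.plus.IsTransfer ξ) :
    ((zero M X).add ξ hξ).cls = (zero M Y).cls :=
  cls_eq_of_bijective (a := (zero M X).add ξ hξ) (b := zero M Y) (𝟙 (zero M X).A)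
    Function.bijective_id (fun x => PEmpty.elim x)
    (M.eq_of_isEmpty (zero_elim (M := M) (X := X)) _ _)

lemma cls_add_sum (ξ : X ⟶ Y) (hξ : T.plus.IsTransfer ξ) (a b : MOver M X) :
    ((a.sum b).add ξ hξ).cls = ((a.add ξ hξ).sum (b.add ξ hξ)).cls := by
  refine (cls_sum_eq (a := a.add ξ hξ) (b := b.add ξ hξ) (c := (a.sum b).add ξ hξ)
    (sum.inl a.A b.A) (sum.inr a.A b.A) Sum.inl_injective Sum.inr_injective
    (fun _ _ => Sum.inl_ne_inr) ?_ (fun _ => rfl) (fun _ => rfl)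
    (M.res_inl_glue _ _) (M.res_inr_glue _ _)).symm
  rintro (x | x)
  · exact Or.inl ⟨x, rfl⟩
  · exact Or.inr ⟨x, rfl⟩

lemma cls_add_id (h : T.plus.IsTransfer (𝟙 X)) (a : MOver M X) :
    (a.add (𝟙 X) h).cls = a.cls :=
  cls_eq_of_bijective (a := a.add (𝟙 X) h) (𝟙 a.A) Function.bijective_id (fun _ => rfl)
    (M.res_eq_self (fun _ => rfl) _)

lemma cls_add_comp (f : X ⟶ Y) (g : Y ⟶ Z) (hf : T.plus.IsTransfer f) (hg : T.plus.IsTransfer g)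
    (a : MOver M X) : (a.add (f ≫ g) (hf.comp hg)).cls = ((a.add f hf).add g hg).cls :=
  cls_eq_of_bijective (a := a.add (f ≫ g) (hf.comp hg)) (b := (a.add f hf).add g hg) (𝟙 a.A)
    Function.bijective_id (fun _ => rfl) (M.res_eq_self (fun _ => rfl) _)

lemma cls_res_add {X' Y' : GSet T.family} {g' : X' ⟶ Y'} {f' : X' ⟶ X} {f : Y' ⟶ Y} {g : X ⟶ Y}
    (h : IsCartesian g' f' f g) (hg : T.plus.IsTransfer g) (hg' : T.plus.IsTransfer g')
    (a : MOver M X) : ((a.add g hg).res f).cls = ((a.res f').add g' hg').cls := by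
  refine cls_res_eq (a := a.add g hg) (c := (a.res f').add g' hg') (fiberProd.fst a.p f')
    ⟨?_, ?_, ?_⟩ rfl
  · exact fun z => (h.comm z.1.2).trans (congrArg g (Eq.symm z.2))
  · exact fun z w h1 h2 => Subtype.ext (Prod.ext h2 (h.inj _ _ h1
      (Eq.trans (Eq.symm z.2) ((congrArg a.p h2).trans w.2))))
  · intro y x e
    obtain ⟨z, hz, hz'⟩ := h.surj y (a.p x) e
    exact ⟨⟨(x, z), hz'.symm⟩, hz, rfl⟩

/-! ### Gluing along disjoint unions -/

/-- The disjoint union of pairs over the members of a decomposition of `X`, with the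
element of `M` glued from those of the summands. -/
noncomputable def sigma {L : Type u} {X' : L → GSet T.family} {i : ∀ l, X' l ⟶ X}
    (hi : IsDecomposition i) (a : ∀ l, MOver M (X' l)) : MOver M X :=
  let A : GSet T.family :=
    { carrier := Σ l, (a l).A
      action :=
      { smul := fun g z => ⟨z.1, g • z.2⟩
        one_smul := fun z => Sigma.ext rfl (heq_of_eq (one_smul G z.2))
        mul_smul := fun g h z => Sigma.ext rfl (heq_of_eq (mul_smul g h z.2)) }
      stab_mem := fun z => by
        convert (a z.1).A.stab_mem z.2
        ext g
        refine ⟨fun h => ?_, fun h => Sigma.ext rfl (heq_of_eq h)⟩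
        exact eq_of_heq (Sigma.ext_iff.1 h).2 }
  let j : ∀ l, (a l).A ⟶ A := fun l => mk' (Y := A) (fun x => ⟨l, x⟩) (fun _ _ => rfl)
  have hj : IsDecomposition j := ⟨fun _ _ h => h, fun z => ⟨z, rfl⟩⟩
  { A := A
    p := mk' (X := A) (fun z => i z.1 ((a z.1).p z.2)) (fun g z => by
      refine Eq.trans ?_ (map_smul' (i z.1) g _)
      exact congrArg (i z.1) (map_smul' (a z.1).p g z.2))
    isTransfer := isTransfer_natural (fun x => by
      obtain ⟨⟨l, x'⟩, rfl⟩ := hi.2 x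
      refine (((a l).isTransfer.1 x').image (fun y => (⟨l, y⟩ : Σ l, (a l).A))).subset ?_
      rintro ⟨k, z⟩ hz
      have := hi.1 (a₁ := ⟨k, (a k).p z⟩) (a₂ := ⟨l, x'⟩) hz
      obtain rfl : k = l := congrArg Sigma.fst this
      exact ⟨z, eq_of_heq (Sigma.ext_iff.1 this).2, rfl⟩)
    m := ((M.isSemiMackey.additive j hj).2 (fun l => (a l).m)).choose }

/-- The inclusion of a summand. -/
noncomputable def sigmaIncl {L : Type u} {X' : L → GSet T.family} {i : ∀ l, X' l ⟶ X}
    (hi : IsDecomposition i) (a : ∀ l, MOver M (X' l)) (l : L) : (a l).A ⟶ (sigma hi a).A :=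
  mk' (Y := (sigma hi a).A) (fun x => ⟨l, x⟩) (fun _ _ => rfl)

lemma isDecomposition_sigmaIncl {L : Type u} {X' : L → GSet T.family} {i : ∀ l, X' l ⟶ X}
    (hi : IsDecomposition i) (a : ∀ l, MOver M (X' l)) : IsDecomposition (sigmaIncl hi a) :=
  ⟨fun _ _ h => h, fun z => ⟨z, rfl⟩⟩

lemma res_sigmaIncl {L : Type u} {X' : L → GSet T.family} {i : ∀ l, X' l ⟶ X}
    (hi : IsDecomposition i) (a : ∀ l, MOver M (X' l)) (l : L) :
    M.res (sigmaIncl hi a l) (sigma hi a).m = (a l).m :=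
  congrFun ((M.isSemiMackey.additive _
    (isDecomposition_sigmaIncl hi a)).2 (fun l => (a l).m)).choose_spec l

lemma cls_res_sigma {L : Type u} {X' : L → GSet T.family} {i : ∀ l, X' l ⟶ X}
    (hi : IsDecomposition i) (a : ∀ l, MOver M (X' l)) (l : L) :
    ((sigma hi a).res (i l)).cls = (a l).cls := by
  refine cls_res_eq (sigmaIncl hi a l) ⟨fun _ => rfl, fun z w _ h => ?_, ?_⟩
    (res_sigmaIncl hi a l)
  · exact eq_of_heq (Sigma.ext_iff.1 h).2
  · rintro y ⟨k, x⟩ h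
    have := hi.1 (a₁ := ⟨l, y⟩) (a₂ := ⟨k, (a k).p x⟩) h
    obtain rfl : l = k := congrArg Sigma.fst this
    exact ⟨x, (eq_of_heq (Sigma.ext_iff.1 this).2).symm, rfl⟩

/-- A pair is recovered from its restrictions to the members of a decomposition of `X`. -/
lemma cls_eq_sigma {L : Type u} {X' : L → GSet T.family} {i : ∀ l, X' l ⟶ X}
    (hi : IsDecomposition i) (a : ∀ l, MOver M (X' l)) (c : MOver M X)
    (h : ∀ l, (c.res (i l)).cls = (a l).cls) : (sigma hi a).cls = c.cls := by
  choose f hf mf using fun l => cls_eq_cls_iff.1 (h l).symm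
  let j : ∀ l, (a l).A ⟶ c.A := fun l => (f l).hom ≫ fiberProd.fst c.p (i l)
  have hj : ∀ l x, c.p (j l x) = i l ((a l).p x) := fun l x =>
    Eq.trans ((f l).hom x).2 (congrArg (i l) (hf l x))
  refine cls_eq_of_bijective (a := sigma hi a) (mk' (X := (sigma hi a).A)
    (fun z => j z.1 z.2) (fun g z => map_smul' (j z.1) g z.2)) ⟨?_, ?_⟩ (fun z => hj z.1 z.2) ?_
  · rintro ⟨k, x⟩ ⟨l, y⟩ e
    have e' : j k x = j l y := e
    have := hi.1 (a₁ := ⟨k, (a k).p x⟩) (a₂ := ⟨l, (a l).p y⟩)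
      ((hj k x).symm.trans ((congrArg c.p e').trans (hj l y)))
    obtain rfl : k = l := congrArg Sigma.fst this
    have hp : (a k).p x = (a k).p y := eq_of_heq (Sigma.ext_iff.1 this).2
    have : x = y := (bijective_of_iso (f k)).1 (Subtype.ext (Prod.ext e'
      ((hf k x).trans (hp.trans (hf k y).symm))))
    rw [this]
  · intro z
    obtain ⟨⟨l, x⟩, hx⟩ := hi.2 (c.p z)
    obtain ⟨y, hy⟩ := (bijective_of_iso (f l)).2 ⟨(z, x), Eq.symm hx⟩
    exact ⟨⟨l, y⟩, congrArg (fun t : fiberProd c.p (i l) => t.1.1) hy⟩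
  · refine M.ext_decomposition (isDecomposition_sigmaIncl hi a) (fun l => ?_)
    refine (M.res_res _ _ _).trans (Eq.trans ?_ (res_sigmaIncl hi a l).symm)
    exact (M.res_trans (fun _ => rfl) rfl).trans (mf l)

end MOver

namespace MOver

variable {M N : SemiMackey T.mul} {X Y Z : GSet T.family}

/-! ### Multiplicative norms -/

lemma cls_mul_congr (η : X ⟶ Y) (hη : T.mul.IsTransfer η) {a a' : MOver M X}
    (h : a.cls = a'.cls) : (a.mul η hη).cls = (a'.mul η hη).cls := by
  obtain ⟨f, hf, mf⟩ := cls_eq_cls_iff.1 h.symm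
  have hf' : ∀ y, a'.p (f.inv y) = a.p y := fun y => (hf _).symm.trans
    (congrArg (fun k : a.A ⟶ a.A => a.p (k y)) f.inv_hom_id)
  refine cls_mul_eq (c := a'.mul η hη) (T.piEval η hη a'.p ≫ f.hom)
    (isCartesian_fiberProd η (T.piMap η hη a'.p)) ?_ ?_ ?_ ?_
  · exact fun e => (hf _).trans (PiSet.p_sec _ _ _)
  · intro z w hb hzw
    exact PiSet.ext' hb (fun x h h' => (bijective_of_iso f).1
      (hzw ⟨(x, z), h⟩ ⟨(x, w), h'⟩ rfl rfl rfl))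
  · intro s
    refine ⟨(⟨s.base, fun x h => f.inv (s.sec x h), fun x h => (hf' _).trans (s.p_sec x h)⟩ :
      PiSet η a'.p), rfl, ?_⟩
    rintro ⟨⟨x, z⟩, h⟩ rfl h'
    exact congrArg (fun k : a.A ⟶ a.A => k (s.sec x h')) f.inv_hom_id
  · exact congrArg (M.tr _ _) (M.res_trans (fun _ => rfl) mf).symm

lemma cls_mul_one (η : X ⟶ Y) (hη : T.mul.IsTransfer η) :
    ((one M X).mul η hη).cls = (one M Y).cls := by
  refine cls_mul_eq (a := one M X) (c := one M Y) (E := X) (ε := 𝟙 X) (ρ := η) (𝟙 X)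
    ⟨fun _ => rfl, fun _ _ _ h => h, fun _ x h => ⟨x, Eq.symm h, rfl⟩⟩ (fun _ => rfl)
    (fun _ _ h _ => h) (fun s => ⟨s.base, rfl, fun e _ h' => (s.p_sec e h').symm⟩) ?_
  exact ((congrArg (M.tr η _) (map_one (M.res (𝟙 X)))).trans (map_one (M.tr η _))).symm

lemma cls_mul_prod (η : X ⟶ Y) (hη : T.mul.IsTransfer η) (a b : MOver M X) :
    ((a.prod b).mul η hη).cls = ((a.mul η hη).prod (b.mul η hη)).cls := by
  let c := (a.mul η hη).prod (b.mul η hη)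
  let la : fiberProd η c.p ⟶ a.A := mk' (X := fiberProd η c.p)
    (fun e => PiSet.sec e.1.2.1.1 e.1.1 (Eq.trans e.2 (Eq.symm e.1.2.2)))
    (fun g e => congrArg (fun t => g • t) (PiSet.sec_congr e.1.2.1.1 (inv_smul_smul g e.1.1) _ _))
  let lb : fiberProd η c.p ⟶ b.A := mk' (X := fiberProd η c.p)
    (fun e => PiSet.sec e.1.2.1.2 e.1.1 e.2)
    (fun g e => congrArg (fun t => g • t) (PiSet.sec_congr e.1.2.1.2 (inv_smul_smul g e.1.1) _ _))
  have ha : ∀ e, a.p (la e) = e.1.1 := fun e => PiSet.p_sec _ _ _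
  have hb : ∀ e, b.p (lb e) = e.1.1 := fun e => PiSet.p_sec _ _ _
  have hc := isCartesian_fiberProd η c.p
  refine cls_mul_eq (a := a.prod b) (c := c)
    (mk' (Y := (a.prod b).A) (fun e => ⟨(la e, lb e), (ha e).trans (hb e).symm⟩)
      (fun g e => Subtype.ext (Prod.ext (map_smul' la g e) (map_smul' lb g e))))
    hc hb ?_ ?_ ?_
  · rintro ⟨⟨s, t⟩, h⟩ ⟨⟨s', t'⟩, k⟩ hp hl
    have hl' : ∀ x (hx : η x = PiSet.base t) (hx' : η x = PiSet.base t'),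
        PiSet.sec s x (Eq.trans hx (Eq.symm h)) = PiSet.sec s' x (Eq.trans hx' (Eq.symm k)) ∧
          PiSet.sec t x hx = PiSet.sec t' x hx' := fun x hx hx' =>
      Prod.ext_iff.1 (Subtype.ext_iff.1 (hl ⟨(x, ⟨(s, t), h⟩), hx⟩ ⟨(x, ⟨(s', t'), k⟩), hx'⟩
        rfl rfl rfl))
    refine Subtype.ext (Prod.ext ?_ ?_)
    · exact PiSet.ext' (Eq.trans h (Eq.trans hp (Eq.symm k)))
        (fun x hx hx' => (hl' x (Eq.trans hx h) (Eq.trans hx' k)).1)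
    · exact PiSet.ext' hp (fun x hx hx' => (hl' x hx hx').2)
  · intro s
    let sa : PiSet η a.p := ⟨s.base, fun x h => (s.sec x h).1.1,
      fun x h => Eq.trans (s.sec x h).2 (s.p_sec x h)⟩
    let sb : PiSet η b.p := ⟨s.base, fun x h => (s.sec x h).1.2, fun x h => s.p_sec x h⟩
    refine ⟨⟨(sa, sb), rfl⟩, rfl, ?_⟩
    rintro ⟨⟨x, z⟩, h⟩ rfl h'
    rfl
  · refine Eq.trans ?_ ((congrArg (M.tr _ _) (map_mul (M.res _) _ _)).trans
      (map_mul (M.tr _ (hc.isTransfer hη)) _ _)).symm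
    refine congrArg₂ (· * ·) ?_ ?_
    · refine Eq.trans ?_ (congrArg (M.tr _ _) (M.res_res _ _ _).symm)
      exact M.res_tr_piEval hη (fiberProd.fst (a.mul η hη).p (b.mul η hη).p) (hc.isTransfer hη)
        (q := c.p) (fun z => z.2) hc (fun _ _ => rfl) a.m
    · refine Eq.trans ?_ (congrArg (M.tr _ _) (M.res_res _ _ _).symm)
      exact M.res_tr_piEval hη (fiberProd.snd (a.mul η hη).p (b.mul η hη).p) (hc.isTransfer hη)
        (q := c.p) (fun _ => rfl) hc (fun _ _ => rfl) b.m

lemma cls_mul_id (h : T.mul.IsTransfer (𝟙 X)) (a : MOver M X) :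
    (a.mul (𝟙 X) h).cls = a.cls := by
  refine cls_mul_eq (E := a.A) (ε := a.p) (ρ := 𝟙 a.A) (𝟙 a.A)
    ⟨fun _ => rfl, fun _ _ h _ => h, fun z _ h => ⟨z, rfl, h⟩⟩ (fun _ => rfl)
    (fun z w hp hl => hl z w rfl rfl hp) (fun s => ⟨s.sec s.base rfl, s.p_sec _ _, ?_⟩) ?_
  · rintro e rfl h'
    exact s.sec_congr (s.p_sec _ _).symm _ _
  · exact ((M.isSemiMackey.tr_id _ _ _).trans (M.isSemiMackey.res_id _ _)).symm

/-- `Π_{g f}(A) ≅ Π_g(Π_f(A))`: a section over `(g f)⁻¹(z)` is a family of sections over the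
fibres `f⁻¹(y)`, `y ∈ g⁻¹(z)`. -/
lemma cls_mul_comp (f : X ⟶ Y) (g : Y ⟶ Z) (hf : T.mul.IsTransfer f) (hg : T.mul.IsTransfer g)
    (a : MOver M X) :
    (a.mul (f ≫ g) (hf.comp hg)).cls = ((a.mul f hf).mul g hg).cls := by
  let b := a.mul f hf
  let c := b.mul g hg
  let E := fiberProd f (fiberProd.fst g c.p)
  let ρ₁ : E ⟶ fiberProd g c.p := fiberProd.snd f (fiberProd.fst g c.p)
  have h₁ : IsCartesian ρ₁ (fiberProd.fst f _) (fiberProd.fst g c.p) f := isCartesian_fiberProd _ _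
  let q : E → PiSet f a.p := fun e => T.piEval g hg b.p e.1.2
  have hq : ∀ e : E, f e.1.1 = (q e).base := fun e =>
    Eq.trans e.2 (Eq.symm (PiSet.p_sec (p := b.p) _ _ _))
  let l : E ⟶ a.A := mk' (X := E) (fun e => (q e).sec e.1.1 (hq e)) (fun k e => by
    have hk : f (k • e.1.1) = (k • q e).base :=
      (map_smul' f k e.1.1).trans (congrArg (fun y => k • y) (hq e))
    refine (PiSet.sec_congr_left (t := k • q e) (map_smul' (T.piEval g hg b.p) k e.1.2) rfl
      (hq (k • e)) hk).trans ?_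
    exact congrArg (fun t => k • t) ((q e).sec_congr (inv_smul_smul k e.1.1)
      (PiSet.inv_smul_mem hk) (hq e)))
  have hc : IsCartesian (ρ₁ ≫ T.piProj g hg b.p) (fiberProd.fst f (fiberProd.fst g c.p))
      c.p (f ≫ g) := by
    refine ⟨?_, ?_, ?_⟩
    · exact fun e => Eq.trans (Eq.symm e.1.2.2) (congrArg g (Eq.symm e.2))
    · rintro ⟨⟨x, ⟨⟨y, z⟩, h⟩⟩, h'⟩ ⟨⟨x', ⟨⟨y', z'⟩, k⟩⟩, k'⟩ h1 h2
      obtain rfl : z = z' := h1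
      obtain rfl : x = x' := h2
      obtain rfl : y = y' := Eq.trans (Eq.symm h') k'
      rfl
    · exact fun z x h => ⟨⟨(x, ⟨(f x, z), Eq.symm h⟩), rfl⟩, rfl, rfl⟩
  refine cls_mul_eq (a := a) (c := c) l hc (fun e => PiSet.p_sec _ _ _) ?_ ?_ ?_
  · intro z w hb hl
    refine PiSet.ext' hb (fun y hy hy' => PiSet.ext'
      (Eq.trans (PiSet.p_sec (p := b.p) z y hy) (Eq.symm (PiSet.p_sec (p := b.p) w y hy'))) ?_)
    intro x hx hx'
    exact hl ⟨(x, ⟨(y, z), hy⟩), Eq.trans hx (PiSet.p_sec (p := b.p) z y hy)⟩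
      ⟨(x, ⟨(y, w), hy'⟩), Eq.trans hx' (PiSet.p_sec (p := b.p) w y hy')⟩ rfl rfl rfl
  · intro s
    let t : PiSet g b.p := ⟨s.base, fun y hy => (⟨y, fun x hx => s.sec x
      (Eq.trans (congrArg g hx) hy), fun x _ => s.p_sec x _⟩ : PiSet f a.p), fun _ _ => rfl⟩
    refine ⟨t, rfl, ?_⟩
    rintro ⟨⟨x, ⟨⟨y, z⟩, h⟩⟩, k⟩ rfl h'
    rfl
  · refine Eq.trans ?_ (M.isSemiMackey.tr_comp _ _ (h₁.isTransfer hf)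
      (T.isTransfer_piProj g hg b.p) _).symm
    exact congrArg (M.tr _ _) (M.res_tr_piEval hf (T.piEval g hg b.p) (h₁.isTransfer hf)
      (q := fiberProd.fst g c.p) (fun e => PiSet.p_sec (p := b.p) _ _ _) h₁ (fun _ _ => rfl) a.m)

/-- Norms commute with base change, since the fibres of `g'` are fibres of `g`. -/
lemma cls_res_mul {X' Y' : GSet T.family} {g' : X' ⟶ Y'} {f' : X' ⟶ X} {f : Y' ⟶ Y} {g : X ⟶ Y}
    (h : IsCartesian g' f' f g) (hg : T.mul.IsTransfer g) (hg' : T.mul.IsTransfer g')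
    (a : MOver M X) : ((a.mul g hg).res f).cls = ((a.res f').mul g' hg').cls := by
  let c := (a.mul g hg).res f
  have hc := isCartesian_fiberProd g' c.p
  have hx : ∀ e : fiberProd g' c.p, g (f' e.1.1) = PiSet.base e.1.2.1.1 := fun e =>
    (h.comm e.1.1).symm.trans ((congrArg f e.2).trans (Eq.symm e.1.2.2))
  let l : fiberProd g' c.p ⟶ a.A := mk' (X := fiberProd g' c.p)
    (fun e => PiSet.sec e.1.2.1.1 (f' e.1.1) (hx e))
    (fun k e => congrArg (fun t => k • t) (PiSet.sec_congr e.1.2.1.1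
      ((congrArg (fun t => k⁻¹ • t) (map_smul' f' k e.1.1)).trans (inv_smul_smul k _)) _ _))
  have hl : ∀ e, a.p (l e) = f' e.1.1 := fun e => PiSet.p_sec _ _ _
  refine (cls_mul_eq (a := a.res f') (c := c) (mk' (Y := (a.res f').A)
      (fun e => ⟨(l e, e.1.1), hl e⟩)
      (fun k e => Subtype.ext (Prod.ext (map_smul' l k e) rfl))) hc (fun _ => rfl) ?_ ?_ ?_).symm
  · rintro ⟨⟨s, y⟩, hs⟩ ⟨⟨t, y'⟩, ht⟩ hp hzw
    obtain rfl : y = y' := hp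
    refine Subtype.ext (Prod.ext (PiSet.ext' (Eq.trans hs (Eq.symm ht)) (fun x hx hx' => ?_)) rfl)
    obtain ⟨x', hy, rfl⟩ := h.surj y x (Eq.symm (Eq.trans hx hs))
    exact congrArg (fun t : fiberProd a.p f' => t.1.1)
      (hzw ⟨(x', ⟨(s, y), hs⟩), hy⟩ ⟨(x', ⟨(t, y), ht⟩), hy⟩ rfl rfl rfl)
  · intro s
    have hs : ∀ x, g x = f s.base → ∃ z, g' z = s.base ∧ f' z = x := fun x hx =>
      h.surj s.base x hx.symm
    let t : PiSet g a.p := ⟨f s.base,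
      fun x hx => (s.sec (hs x hx).choose (hs x hx).choose_spec.1).1.1, fun x hx =>
        Eq.trans (s.sec (hs x hx).choose (hs x hx).choose_spec.1).2
          ((congrArg f' (s.p_sec _ _)).trans (hs x hx).choose_spec.2)⟩
    refine ⟨⟨(t, s.base), rfl⟩, rfl, ?_⟩
    rintro ⟨⟨x, z⟩, hz⟩ rfl h'
    refine Subtype.ext (Prod.ext ?_ (s.p_sec x h').symm)
    have h3 := hs (f' x) (hx ⟨(x, ⟨(t, s.base), rfl⟩), hz⟩)
    have h4 : s.sec h3.choose h3.choose_spec.1 = s.sec x h' :=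
      s.sec_congr (h.inj _ _ (Eq.trans h3.choose_spec.1 (Eq.symm h')) h3.choose_spec.2) _ _
    exact congrArg (fun t => t.1.1) h4
  · refine Eq.trans ?_ (congrArg (M.tr _ _) (M.res_res _ _ _).symm)
    refine M.res_tr_piEval hg (fiberProd.fst (a.mul g hg).p f) (hc.isTransfer hg')
      (ε := fiberProd.fst g' c.p ≫ f') (q := c.p ≫ f) (fun z => z.2) ⟨?_, ?_, ?_⟩
      (fun _ _ => rfl) a.m
    · exact fun e => (congrArg f (Eq.symm e.2)).trans (h.comm e.1.1)
    · exact fun d e h1 h2 => Subtype.ext (Prod.ext (h.inj _ _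
        (Eq.trans d.2 ((congrArg c.p h1).trans (Eq.symm e.2))) h2) h1)
    · intro z x e
      obtain ⟨x', hx', rfl⟩ := h.surj (c.p z) x e
      exact ⟨⟨(x', z), hx'⟩, rfl, rfl⟩

/-- The distributive law for the canonical exponential diagram: a section of `B → Z → X` over
`η⁻¹(y)` is a section `s` of `Z → X` together with a section of `B` along `s`. -/
lemma cls_mul_add (η : X ⟶ Y) (hη : T.mul.IsTransfer η) (ξ : Z ⟶ X) (hξ : T.plus.IsTransfer ξ)
    (b : MOver M Z) :
    ((b.add ξ hξ).mul η hη).cls =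
      (((b.res (T.piEval η hη ξ)).mul (T.piProj η hη ξ) (T.isTransfer_piProj η hη ξ)).add
        (T.piMap η hη ξ) (T.isTransfer_piMap η hη ξ hξ)).cls := by
  let ev := T.piEval η hη ξ
  let pr := T.piProj η hη ξ
  let hpr := T.isTransfer_piProj η hη ξ
  let d := b.res ev
  have h₁ := isCartesian_fiberProd pr (T.piMap pr hpr d.p)
  have hc : IsCartesian (T.piProj pr hpr d.p)
      (fiberProd.fst pr (T.piMap pr hpr d.p) ≫ fiberProd.fst η (T.piMap η hη ξ))
      (T.piMap pr hpr d.p ≫ T.piMap η hη ξ) η := by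
    refine ⟨?_, ?_, ?_⟩
    · exact fun e => (congrArg PiSet.base (Eq.symm e.2)).trans (Eq.symm e.1.1.2)
    · exact fun e e' h1 h2 => h₁.inj e e' h1 (Subtype.ext (Prod.ext h2
        (Eq.trans e.2 ((congrArg PiSet.base h1).trans (Eq.symm e'.2)))))
    · exact fun z x h => ⟨⟨(⟨(x, PiSet.base z), Eq.symm h⟩, z), rfl⟩, rfl, rfl⟩
  refine cls_mul_eq (a := b.add ξ hξ)
    (c := (d.mul pr hpr).add (T.piMap η hη ξ) (T.isTransfer_piMap η hη ξ hξ))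
    (T.piEval pr hpr d.p ≫ fiberProd.fst b.p ev) hc ?_ ?_ ?_ ?_
  · intro e
    refine (congrArg ξ (T.piEval pr hpr d.p e).2).trans ((PiSet.p_sec (p := ξ) _ _ _).trans ?_)
    exact congrArg (fun t : fiberProd η (T.piMap η hη ξ) => t.1.1)
      (PiSet.p_sec (p := d.p) e.1.2 e.1.1 e.2)
  · rintro (⟨s, σ, hσ⟩ : PiSet pr d.p) (⟨t, τ, hτ⟩ : PiSet pr d.p) hp hl
    -- the underlying section of `Z` is the image of the section of `B`
    have key : ∀ (w : PiSet pr d.p) (v : fiberProd η (T.piMap η hη ξ)) (hv : pr v = w.base),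
        b.p (w.sec v hv).1.1 = PiSet.sec v.1.2 v.1.1 v.2 := fun w v hv =>
      Eq.trans (w.sec v hv).2 (congrArg ev (w.p_sec v hv))
    have hst : s = t := by
      refine PiSet.ext' hp (fun x hx hx' => ?_)
      refine (key ⟨s, σ, hσ⟩ ⟨(x, s), hx⟩ rfl).symm.trans
        (Eq.trans ?_ (key ⟨t, τ, hτ⟩ ⟨(x, t), hx'⟩ rfl))
      exact congrArg b.p (hl ⟨(⟨(x, s), hx⟩, (⟨s, σ, hσ⟩ : PiSet pr d.p)), rfl⟩
        ⟨(⟨(x, t), hx'⟩, (⟨t, τ, hτ⟩ : PiSet pr d.p)), rfl⟩ rfl rfl rfl)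
    subst hst
    refine PiSet.ext' rfl (fun v hv hv' => Subtype.ext (Prod.ext ?_
      (Eq.trans (hσ v hv) (Eq.symm (hτ v hv')))))
    exact hl ⟨(v, (⟨s, σ, hσ⟩ : PiSet pr d.p)), hv⟩ ⟨(v, (⟨s, τ, hτ⟩ : PiSet pr d.p)), hv'⟩
      rfl rfl rfl
  · intro s
    let t : PiSet η ξ := ⟨s.base, fun x hx => b.p (s.sec x hx), fun x hx => s.p_sec x hx⟩
    let w : PiSet pr d.p := ⟨t, fun v hv => ⟨(s.sec v.1.1
      (Eq.trans v.2 (congrArg PiSet.base hv)), v), by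
        obtain ⟨⟨x, t'⟩, hx⟩ := v
        obtain rfl : t' = t := hv
        rfl⟩, fun _ _ => rfl⟩
    refine ⟨w, rfl, ?_⟩
    rintro ⟨⟨v, z⟩, hz⟩ rfl h'
    rfl
  · exact congrArg (M.tr _ _) (M.res_res _ _ _)

/-- The distributive law for an arbitrary exponential diagram. -/
lemma cls_exponential {X' Y' : GSet T.family} (η : X ⟶ Y) (hη : T.mul.IsTransfer η)
    (ξ : Z ⟶ X) (hξ : T.plus.IsTransfer ξ) (ζ : X' ⟶ Z) (η' : X' ⟶ Y')
    (hη' : T.mul.IsTransfer η') (υ : Y' ⟶ Y) (hυ : T.plus.IsTransfer υ)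
    (h : T.IsExponential η hη ξ ζ η' υ) (s : MOver M Z) :
    (((s.res ζ).mul η' hη').add υ hυ).cls = ((s.add ξ hξ).mul η hη).cls := by
  obtain ⟨b, a, rfl, hρ, rfl⟩ := h
  have hb := bijective_of_iso b
  have ha := bijective_of_iso a
  have hc : IsCartesian η' a.hom b.hom (T.piProj η hη ξ) := by
    have hρ' : ∀ x, T.piProj η hη ξ (a.hom x) = b.hom (η' x) := fun x =>
      congrArg (fun k : X' ⟶ T.pi η hη ξ => k x) hρ
    refine ⟨fun x => (hρ' x).symm, fun _ _ _ h => ha.1 h, fun y x h => ?_⟩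
    obtain ⟨x, rfl⟩ := ha.2 x
    exact ⟨x, hb.1 ((hρ' x).symm.trans h.symm), rfl⟩
  rw [cls_mul_add]
  let t := (s.res (T.piEval η hη ξ)).mul (T.piProj η hη ξ) (T.isTransfer_piProj η hη ξ)
  have e : ((s.res (a.hom ≫ T.piEval η hη ξ)).mul η' hη').cls = (t.res b.hom).cls :=
    (cls_mul_congr η' hη' (cls_res_comp _ _ s)).trans (cls_res_mul hc _ hη' _).symm
  refine (cls_add_congr _ hυ e).trans ?_
  refine cls_eq_of_bijective (a := (t.res b.hom).add _ hυ) (fiberProd.fst t.p b.hom) ⟨?_, ?_⟩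
    (fun z => congrArg (T.piMap η hη ξ) z.2) rfl
  · exact fun z w h => Subtype.ext (Prod.ext h (hb.1
      (Eq.trans (Eq.symm z.2) ((congrArg t.p h).trans w.2))))
  · intro z
    obtain ⟨y, hy⟩ := hb.2 (t.p z)
    exact ⟨⟨(z, y), Eq.symm hy⟩, rfl⟩

/-! ### Functoriality in the semi-Mackey functor -/

lemma cls_map_congr (φ : M ⟶ N) {a a' : MOver M X} (h : a.cls = a'.cls) :
    (a.map φ).cls = (a'.map φ).cls := by
  obtain ⟨f, hf, mf⟩ := cls_eq_cls_iff.1 h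
  exact cls_eq_cls_iff.2 ⟨f, hf, (SemiMackey.Hom.res_app φ f.hom a'.m).symm.trans
    (congrArg (SemiMackey.Hom.app φ a.A) mf)⟩

lemma map_zero (φ : M ⟶ N) : (zero M X).map φ = zero N X :=
  congrArg (MOver.mk _ _ _) (_root_.map_one (SemiMackey.Hom.app φ _))

lemma map_one (φ : M ⟶ N) : (one M X).map φ = one N X :=
  congrArg (MOver.mk _ _ _) (_root_.map_one (SemiMackey.Hom.app φ _))

lemma map_sum (φ : M ⟶ N) (a b : MOver M X) : (a.sum b).map φ = (a.map φ).sum (b.map φ) := by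
  refine congrArg (MOver.mk _ _ _) (N.ext_sum ?_ ?_)
  · refine Eq.trans ?_ (N.res_inl_glue _ _).symm
    exact (SemiMackey.Hom.res_app φ _ _).symm.trans
      (congrArg (SemiMackey.Hom.app φ a.A) (M.res_inl_glue a.m b.m))
  · refine Eq.trans ?_ (N.res_inr_glue _ _).symm
    exact (SemiMackey.Hom.res_app φ _ _).symm.trans
      (congrArg (SemiMackey.Hom.app φ b.A) (M.res_inr_glue a.m b.m))

lemma map_prod (φ : M ⟶ N) (a b : MOver M X) : (a.prod b).map φ = (a.map φ).prod (b.map φ) :=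
  congrArg (MOver.mk _ _ _) ((map_mul (SemiMackey.Hom.app φ _) _ _).trans
    (congrArg₂ (· * ·) (SemiMackey.Hom.res_app φ _ _) (SemiMackey.Hom.res_app φ _ _)))

lemma map_res (φ : M ⟶ N) (ζ : Y ⟶ X) (a : MOver M X) : (a.res ζ).map φ = (a.map φ).res ζ :=
  congrArg (MOver.mk _ _ _) (SemiMackey.Hom.res_app φ _ _)

lemma map_mul (φ : M ⟶ N) (η : X ⟶ Y) (hη : T.mul.IsTransfer η) (a : MOver M X) :
    (a.mul η hη).map φ = (a.map φ).mul η hη :=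
  congrArg (MOver.mk _ _ _) ((SemiMackey.Hom.tr_app φ _ _ _).trans
    (congrArg (N.tr _ _) (SemiMackey.Hom.res_app φ _ _)))

end MOver

/-! ### The semiring of isomorphism classes -/

namespace IsoClasses

variable {M N : SemiMackey T.mul} {X Y Z : GSet T.family}

lemma exists_cls (s : IsoClasses M X) : ∃ a : MOver M X, a.cls = s :=
  Quotient.exists_rep s

noncomputable instance : Add (IsoClasses M X) :=
  ⟨Quotient.lift₂ (fun a b => (a.sum b).cls) (fun _ _ _ _ h h' =>
    MOver.cls_sum_congr (Quotient.sound h) (Quotient.sound h'))⟩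

instance : Mul (IsoClasses M X) :=
  ⟨Quotient.lift₂ (fun a b => (a.prod b).cls) (fun _ _ _ _ h h' =>
    MOver.cls_prod_congr (Quotient.sound h) (Quotient.sound h'))⟩

instance : Zero (IsoClasses M X) := ⟨(MOver.zero M X).cls⟩

instance : One (IsoClasses M X) := ⟨(MOver.one M X).cls⟩

protected lemma add_comm (s t : IsoClasses M X) : s + t = t + s := by
  obtain ⟨a, rfl⟩ := s.exists_cls
  obtain ⟨b, rfl⟩ := t.exists_cls
  exact MOver.cls_sum_comm a b

protected lemma mul_comm (s t : IsoClasses M X) : s * t = t * s := by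
  obtain ⟨a, rfl⟩ := s.exists_cls
  obtain ⟨b, rfl⟩ := t.exists_cls
  exact MOver.cls_prod_comm a b

protected lemma add_assoc (s t r : IsoClasses M X) : s + t + r = s + (t + r) := by
  obtain ⟨a, rfl⟩ := s.exists_cls
  obtain ⟨b, rfl⟩ := t.exists_cls
  obtain ⟨c, rfl⟩ := r.exists_cls
  exact MOver.cls_sum_assoc a b c

protected lemma mul_assoc (s t r : IsoClasses M X) : s * t * r = s * (t * r) := by
  obtain ⟨a, rfl⟩ := s.exists_cls
  obtain ⟨b, rfl⟩ := t.exists_cls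
  obtain ⟨c, rfl⟩ := r.exists_cls
  exact MOver.cls_prod_assoc a b c

protected lemma zero_add (s : IsoClasses M X) : 0 + s = s := by
  obtain ⟨a, rfl⟩ := s.exists_cls
  exact MOver.cls_zero_sum a

protected lemma one_mul (s : IsoClasses M X) : 1 * s = s := by
  obtain ⟨a, rfl⟩ := s.exists_cls
  exact MOver.cls_one_prod a

protected lemma zero_mul (s : IsoClasses M X) : 0 * s = 0 := by
  obtain ⟨a, rfl⟩ := s.exists_cls
  exact MOver.cls_zero_prod a

protected lemma add_mul (s t r : IsoClasses M X) : (s + t) * r = s * r + t * r := by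
  obtain ⟨a, rfl⟩ := s.exists_cls
  obtain ⟨b, rfl⟩ := t.exists_cls
  obtain ⟨c, rfl⟩ := r.exists_cls
  exact MOver.cls_sum_prod a b c

noncomputable instance : CommSemiring (IsoClasses M X) where
  add_assoc := IsoClasses.add_assoc
  add_comm := IsoClasses.add_comm
  zero_add := IsoClasses.zero_add
  add_zero s := (IsoClasses.add_comm s 0).trans (IsoClasses.zero_add s)
  nsmul := nsmulRec
  mul_assoc := IsoClasses.mul_assoc
  mul_comm := IsoClasses.mul_comm
  one_mul := IsoClasses.one_mul
  mul_one s := (IsoClasses.mul_comm s 1).trans (IsoClasses.one_mul s)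
  zero_mul := IsoClasses.zero_mul
  mul_zero s := (IsoClasses.mul_comm s 0).trans (IsoClasses.zero_mul s)
  right_distrib := IsoClasses.add_mul
  left_distrib r s t := by
    rw [IsoClasses.mul_comm, IsoClasses.add_mul, IsoClasses.mul_comm s, IsoClasses.mul_comm t]

/-- The restriction `ζ^*` on isomorphism classes. -/
noncomputable def resHom (M : SemiMackey T.mul) (ζ : Y ⟶ X) :
    IsoClasses M X →+* IsoClasses M Y where
  toFun := Quotient.lift (fun a => (a.res ζ).cls) (fun _ _ h =>
    MOver.cls_res_congr ζ (Quotient.sound h))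
  map_zero' := MOver.cls_res_zero ζ
  map_one' := MOver.cls_res_one ζ
  map_add' s t := by
    obtain ⟨a, rfl⟩ := s.exists_cls
    obtain ⟨b, rfl⟩ := t.exists_cls
    exact MOver.cls_res_sum ζ a b
  map_mul' s t := by
    obtain ⟨a, rfl⟩ := s.exists_cls
    obtain ⟨b, rfl⟩ := t.exists_cls
    exact MOver.cls_res_prod ζ a b

/-- The additive transfer `ξ_+` on isomorphism classes. -/
noncomputable def addHom (M : SemiMackey T.mul) (ξ : X ⟶ Y) (hξ : T.plus.IsTransfer ξ) :
    IsoClasses M X →+ IsoClasses M Y where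
  toFun := Quotient.lift (fun a => (a.add ξ hξ).cls) (fun _ _ h =>
    MOver.cls_add_congr ξ hξ (Quotient.sound h))
  map_zero' := MOver.cls_add_zero ξ hξ
  map_add' s t := by
    obtain ⟨a, rfl⟩ := s.exists_cls
    obtain ⟨b, rfl⟩ := t.exists_cls
    exact MOver.cls_add_sum ξ hξ a b

/-- The multiplicative norm `η_•` on isomorphism classes. -/
noncomputable def mulHom (M : SemiMackey T.mul) (η : X ⟶ Y) (hη : T.mul.IsTransfer η) :
    IsoClasses M X →* IsoClasses M Y where
  toFun := Quotient.lift (fun a => (a.mul η hη).cls) (fun _ _ h =>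
    MOver.cls_mul_congr η hη (Quotient.sound h))
  map_one' := MOver.cls_mul_one η hη
  map_mul' s t := by
    obtain ⟨a, rfl⟩ := s.exists_cls
    obtain ⟨b, rfl⟩ := t.exists_cls
    exact MOver.cls_mul_prod η hη a b

/-- The map on isomorphism classes induced by a morphism of semi-Mackey functors. -/
noncomputable def mapHom (φ : M ⟶ N) (X : GSet T.family) : IsoClasses M X →+* IsoClasses N X where
  toFun := Quotient.lift (fun a => (a.map φ).cls) (fun _ _ h =>
    MOver.cls_map_congr φ (Quotient.sound h))
  map_zero' := congrArg MOver.cls (MOver.map_zero φ)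
  map_one' := congrArg MOver.cls (MOver.map_one φ)
  map_add' s t := by
    obtain ⟨a, rfl⟩ := s.exists_cls
    obtain ⟨b, rfl⟩ := t.exists_cls
    exact congrArg MOver.cls (MOver.map_sum φ a b)
  map_mul' s t := by
    obtain ⟨a, rfl⟩ := s.exists_cls
    obtain ⟨b, rfl⟩ := t.exists_cls
    exact congrArg MOver.cls (MOver.map_prod φ a b)

end IsoClasses

/-! ### Smallness -/

/-- A pair `(A ⟶ X, m)` whose `G`-set `A` is carried by a subset of `X × ℕ`. -/
structure SubsetPair (M : SemiMackey T.mul) (X : GSet T.family) : Type u where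
  s : Set (X × ℕ)
  [action : MulAction G s]
  stab_mem : ∀ x : s, MulAction.stabilizer G x ∈ T.family.C
  p : (⟨s, stab_mem⟩ : GSet T.family) ⟶ X
  isTransfer : T.plus.IsTransfer p
  m : M.obj ⟨s, stab_mem⟩

/-- The isomorphism classes form a small set: since `p : A ⟶ X` has finite fibres, `A` embeds into
`X × ℕ` over `X`. -/
instance (M : SemiMackey T.mul) (X : GSet T.family) : Small.{u} (IsoClasses M X) := by
  let F : SubsetPair M X → IsoClasses M X := fun c =>
    MOver.cls ⟨@GSet.mk _ _ _ c.s c.action c.stab_mem, c.p, c.isTransfer, c.m⟩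
  refine small_of_surjective (f := F) (fun s => ?_)
  obtain ⟨a, rfl⟩ := s.exists_cls
  have hn : ∀ y : X, ∃ n : {x : a.A | a.p x = y} → ℕ, Function.Injective n := fun y => by
    have : Finite {x : a.A | a.p x = y} := a.isTransfer.1 y
    exact exists_injective_nat _
  -- `n y` numbers the points of the fibre over `y`
  choose n hn using hn
  let ι : a.A → X × ℕ := fun x => (a.p x, n (a.p x) ⟨x, rfl⟩)
  have hι : Function.Injective ι := by
    intro x x' h
    have h1 : a.p x = a.p x' := (Prod.ext_iff.1 h).1
    have h2 : n (a.p x) ⟨x, rfl⟩ = n (a.p x') ⟨x', rfl⟩ := (Prod.ext_iff.1 h).2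
    have key : ∀ (y y' : X) (e : y = y') (t : {x : a.A | a.p x = y})
        (t' : {x : a.A | a.p x = y'}), n y t = n y' t' → t.1 = t'.1 := by
      rintro y _ rfl t t' ht
      exact congrArg Subtype.val (hn y ht)
    exact key _ _ h1 _ _ h2
  let e : a.A ≃ Set.range ι := Equiv.ofInjective ι hι
  let act : MulAction G (Set.range ι) := e.symm.mulAction G
  have hact : ∀ (g : G) (x : Set.range ι), e.symm (g • x) = g • e.symm x := fun g x =>
    e.symm_apply_apply _
  have hst : ∀ x : Set.range ι, MulAction.stabilizer G x ∈ T.family.C := fun x => by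
    have : MulAction.stabilizer G x = MulAction.stabilizer G (e.symm x) := by
      ext g
      rw [MulAction.mem_stabilizer_iff, MulAction.mem_stabilizer_iff, ← hact]
      exact e.symm.injective.eq_iff.symm
    rw [this]
    exact a.A.stab_mem _
  let B : GSet T.family := ⟨Set.range ι, hst⟩
  let f : B ⟶ a.A := mk' (X := B) e.symm hact
  have hf : Function.Bijective f := e.symm.bijective
  have hfp : T.plus.IsTransfer (f ≫ a.p) := isTransfer_natural (fun y =>
    Set.Finite.preimage hf.1.injOn (a.isTransfer.1 y))
  exact ⟨⟨Set.range ι, hst, f ≫ a.p, hfp, M.res f a.m⟩,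
    MOver.cls_eq_of_bijective (a := ⟨B, f ≫ a.p, hfp, M.res f a.m⟩) f hf (fun _ => rfl) rfl⟩

/-! ### The semi-Tambara functor -/

/-- The class of a pair in the small model of `IsoClasses M X`. -/
noncomputable def MOver.toShrink {M : SemiMackey T.mul} {X : GSet T.family} (a : MOver M X) :
    Shrink.{u} (IsoClasses M X) := (Shrink.ringEquiv (IsoClasses M X)).symm a.cls

lemma exists_toShrink {M : SemiMackey T.mul} {X : GSet T.family} (s : Shrink.{u} (IsoClasses M X)) :
    ∃ a : MOver M X, a.toShrink = s := by
  obtain ⟨a, ha⟩ := (Shrink.ringEquiv (IsoClasses M X) s).exists_cls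
  exact ⟨a, (congrArg _ ha).trans (RingEquiv.symm_apply_apply _ s)⟩

namespace MOver

variable {M N : SemiMackey T.mul} {X Y Z : GSet T.family}

lemma toShrink_eq_iff {a b : MOver M X} : a.toShrink = b.toShrink ↔ a.cls = b.cls :=
  (Shrink.ringEquiv (IsoClasses M X)).symm.injective.eq_iff

/-- Restriction on the small model. -/
noncomputable def shrinkRes (M : SemiMackey T.mul) (ζ : Y ⟶ X) :
    Shrink.{u} (IsoClasses M X) →+* Shrink.{u} (IsoClasses M Y) :=
  (Shrink.ringEquiv _).symm.toRingHom.comp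
    ((IsoClasses.resHom M ζ).comp (Shrink.ringEquiv _).toRingHom)

/-- Additive transfer on the small model. -/
noncomputable def shrinkAdd (M : SemiMackey T.mul) (ξ : X ⟶ Y) (hξ : T.plus.IsTransfer ξ) :
    Shrink.{u} (IsoClasses M X) →+ Shrink.{u} (IsoClasses M Y) :=
  (Shrink.ringEquiv _).symm.toRingHom.toAddMonoidHom.comp
    ((IsoClasses.addHom M ξ hξ).comp (Shrink.ringEquiv _).toRingHom.toAddMonoidHom)

/-- Multiplicative norm on the small model. -/
noncomputable def shrinkMul (M : SemiMackey T.mul) (η : X ⟶ Y) (hη : T.mul.IsTransfer η) :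
    Shrink.{u} (IsoClasses M X) →* Shrink.{u} (IsoClasses M Y) :=
  (Shrink.ringEquiv _).symm.toRingHom.toMonoidHom.comp
    ((IsoClasses.mulHom M η hη).comp (Shrink.ringEquiv _).toRingHom.toMonoidHom)

/-- The map on small models induced by a morphism of semi-Mackey functors. -/
noncomputable def shrinkMap (φ : M ⟶ N) (X : GSet T.family) :
    Shrink.{u} (IsoClasses M X) →+* Shrink.{u} (IsoClasses N X) :=
  (Shrink.ringEquiv _).symm.toRingHom.comp
    ((IsoClasses.mapHom φ X).comp (Shrink.ringEquiv _).toRingHom)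

lemma shrinkRes_toShrink (ζ : Y ⟶ X) (a : MOver M X) :
    shrinkRes M ζ a.toShrink = (a.res ζ).toShrink :=
  congrArg (fun s => (Shrink.ringEquiv _).symm (IsoClasses.resHom M ζ s))
    (RingEquiv.apply_symm_apply _ a.cls)

lemma shrinkAdd_toShrink (ξ : X ⟶ Y) (hξ : T.plus.IsTransfer ξ) (a : MOver M X) :
    shrinkAdd M ξ hξ a.toShrink = (a.add ξ hξ).toShrink :=
  congrArg (fun s => (Shrink.ringEquiv _).symm (IsoClasses.addHom M ξ hξ s))
    (RingEquiv.apply_symm_apply _ a.cls)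

lemma shrinkMul_toShrink (η : X ⟶ Y) (hη : T.mul.IsTransfer η) (a : MOver M X) :
    shrinkMul M η hη a.toShrink = (a.mul η hη).toShrink :=
  congrArg (fun s => (Shrink.ringEquiv _).symm (IsoClasses.mulHom M η hη s))
    (RingEquiv.apply_symm_apply _ a.cls)

lemma shrinkMap_toShrink (φ : M ⟶ N) (a : MOver M X) :
    shrinkMap φ X a.toShrink = (a.map φ).toShrink :=
  congrArg (fun s => (Shrink.ringEquiv _).symm (IsoClasses.mapHom φ X s))
    (RingEquiv.apply_symm_apply _ a.cls)

lemma shrinkRes_id (s : Shrink.{u} (IsoClasses M X)) : shrinkRes M (𝟙 X) s = s := by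
  obtain ⟨a, rfl⟩ := exists_toShrink s
  rw [shrinkRes_toShrink, toShrink_eq_iff]
  exact cls_res_id a

lemma shrinkRes_comp (f : X ⟶ Y) (g : Y ⟶ Z) (s : Shrink.{u} (IsoClasses M Z)) :
    shrinkRes M (f ≫ g) s = shrinkRes M f (shrinkRes M g s) := by
  obtain ⟨a, rfl⟩ := exists_toShrink s
  rw [shrinkRes_toShrink, shrinkRes_toShrink, shrinkRes_toShrink, toShrink_eq_iff]
  exact cls_res_comp f g a

/-- Additivity of `𝒮_M`, for the additive and the multiplicative structure alike. -/
lemma shrinkRes_bijective {L : Type u} {X' : L → GSet T.family} (i : ∀ l, X' l ⟶ X)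
    (hi : IsDecomposition i) : Function.Bijective
      (fun (s : Shrink.{u} (IsoClasses M X)) (l : L) => shrinkRes M (i l) s) := by
  constructor
  · intro s t h
    obtain ⟨a, rfl⟩ := exists_toShrink s
    obtain ⟨b, rfl⟩ := exists_toShrink t
    have h' : ∀ l, (a.res (i l)).cls = (b.res (i l)).cls := fun l => by
      rw [← toShrink_eq_iff, ← shrinkRes_toShrink, ← shrinkRes_toShrink]
      exact congrFun h l
    rw [toShrink_eq_iff, ← cls_eq_sigma hi (fun l => b.res (i l)) a h',
      cls_eq_sigma hi (fun l => b.res (i l)) b (fun _ => rfl)]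
  · intro t
    choose a ha using fun l => exists_toShrink (t l)
    refine ⟨(sigma hi a).toShrink, funext fun l => ?_⟩
    change shrinkRes M (i l) _ = _
    rw [shrinkRes_toShrink, ← ha, toShrink_eq_iff]
    exact cls_res_sigma hi a l

end MOver

open MOver

/-- The semi-Tambara functor `𝒮_M` of isomorphism classes of pairs `(A ⟶ X, m ∈ M(A))`. -/
noncomputable def tambarization (M : SemiMackey T.mul) : SemiTambara T where
  obj X := Shrink.{u} (IsoClasses M X)
  res ζ := shrinkRes M ζ
  add ξ hξ := shrinkAdd M ξ hξ
  mul η hη := shrinkMul M η hη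
  isSemiMackey_add :=
    { res_id := fun X s => shrinkRes_id (M := M) (X := X) s
      res_comp := fun f g s => shrinkRes_comp (M := M) f g s
      tr_id := fun X h s => by
        obtain ⟨a, ha⟩ := exists_toShrink (M := M) (X := X) (Multiplicative.toAdd s)
        obtain rfl : Multiplicative.ofAdd a.toShrink = s := ha
        exact (shrinkAdd_toShrink _ _ _).trans (toShrink_eq_iff.2 (cls_add_id h a))
      tr_comp := fun {X Y Z} f g hf hg s => by
        obtain ⟨a, ha⟩ := exists_toShrink (M := M) (X := X) (Multiplicative.toAdd s)
        obtain rfl : Multiplicative.ofAdd a.toShrink = s := ha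
        refine (shrinkAdd_toShrink _ _ _).trans (Eq.trans ?_ (congrArg (shrinkAdd M g hg)
          (shrinkAdd_toShrink f hf a)).symm)
        rw [shrinkAdd_toShrink, toShrink_eq_iff]
        exact cls_add_comp f g hf hg a
      mackey := fun {X Y X' Y' g' f' f g} h hg hg' s => by
        obtain ⟨a, ha⟩ := exists_toShrink (M := M) (X := X) (Multiplicative.toAdd s)
        obtain rfl : Multiplicative.ofAdd a.toShrink = s := ha
        refine (congrArg (shrinkRes M f) (shrinkAdd_toShrink g hg a)).trans
          (Eq.trans ?_ (congrArg (shrinkAdd M g' hg') (shrinkRes_toShrink f' a)).symm)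
        rw [shrinkRes_toShrink, shrinkAdd_toShrink, toShrink_eq_iff]
        exact cls_res_add (isCartesian_of_isPullback h) hg hg' a
      additive := fun i hi => shrinkRes_bijective (M := M) i hi }
  isSemiMackey_mul :=
    { res_id := fun X s => shrinkRes_id s
      res_comp := fun f g s => shrinkRes_comp f g s
      tr_id := fun X h s => by
        obtain ⟨a, rfl⟩ := exists_toShrink s
        rw [shrinkMul_toShrink, toShrink_eq_iff]
        exact cls_mul_id h a
      tr_comp := fun f g hf hg s => by
        obtain ⟨a, rfl⟩ := exists_toShrink s
        rw [shrinkMul_toShrink, shrinkMul_toShrink, shrinkMul_toShrink, toShrink_eq_iff]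
        exact cls_mul_comp f g hf hg a
      mackey := fun {X Y X' Y' g' f' f g} h hg hg' s => by
        obtain ⟨a, rfl⟩ := exists_toShrink s
        change shrinkRes M f _ = shrinkMul M g' hg' (shrinkRes M f' _)
        rw [shrinkMul_toShrink, shrinkRes_toShrink, shrinkRes_toShrink, shrinkMul_toShrink,
          toShrink_eq_iff]
        exact cls_res_mul (isCartesian_of_isPullback h) hg hg' a
      additive := fun i hi => shrinkRes_bijective i hi }
  exponential η hη ξ hξ ζ η' hη' υ hυ h s := by
    obtain ⟨a, rfl⟩ := exists_toShrink s
    rw [shrinkRes_toShrink, shrinkMul_toShrink, shrinkAdd_toShrink, shrinkAdd_toShrink,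
      shrinkMul_toShrink, toShrink_eq_iff]
    exact cls_exponential η hη ξ hξ ζ η' hη' υ hυ h a

/-- The morphism `𝒮_φ : 𝒮_M ⟶ 𝒮_N`. -/
noncomputable def tambarizationMap {M N : SemiMackey T.mul} (φ : M ⟶ N) :
    SemiTambara.Hom (tambarization M) (tambarization N) where
  app X := shrinkMap φ X
  res_app f s := by
    obtain ⟨a, rfl⟩ := exists_toShrink s
    change shrinkMap φ _ (shrinkRes M f _) = shrinkRes N f (shrinkMap φ _ _)
    rw [shrinkRes_toShrink, shrinkMap_toShrink, shrinkMap_toShrink, shrinkRes_toShrink, map_res]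
  add_app f hf s := by
    obtain ⟨a, rfl⟩ := exists_toShrink s
    change shrinkMap φ _ (shrinkAdd M f hf _) = shrinkAdd N f hf (shrinkMap φ _ _)
    rw [shrinkAdd_toShrink, shrinkMap_toShrink, shrinkMap_toShrink, shrinkAdd_toShrink]
    rfl
  mul_app f hf s := by
    obtain ⟨a, rfl⟩ := exists_toShrink s
    change shrinkMap φ _ (shrinkMul M f hf _) = shrinkMul N f hf (shrinkMap φ _ _)
    rw [shrinkMul_toShrink, shrinkMap_toShrink, shrinkMap_toShrink, shrinkMul_toShrink,
      MOver.map_mul]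

/-- The functor `M ↦ 𝒮_M`. -/
noncomputable def tambarizationFunctor (T : TambaraSystem G) :
    SemiMackey T.mul ⥤ SemiTambara T where
  obj M := tambarization M
  map φ := tambarizationMap φ
  map_id M := SemiTambara.Hom.ext (funext fun X => RingHom.ext fun s => by
    obtain ⟨a, rfl⟩ := exists_toShrink s
    exact shrinkMap_toShrink (𝟙 M) a)
  map_comp {M N P} φ ψ := SemiTambara.Hom.ext (funext fun X => RingHom.ext fun s => by
    obtain ⟨a, rfl⟩ := exists_toShrink s
    refine (shrinkMap_toShrink (φ ≫ ψ) a).trans (Eq.trans ?_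
      (congrArg (shrinkMap ψ X) (shrinkMap_toShrink φ a)).symm)
    rw [shrinkMap_toShrink]
    rfl)

end Tambarization

theorem theorem1 {G : Type u} [Group G] (T : TambaraSystem G) :
    ∃ (S : SemiMackey T.mul ⥤ SemiTambara T)
      (e : ∀ (M : SemiMackey T.mul) (X : GSet T.family), IsoClasses M X ≃ (S.obj M).obj X),
      (∀ (M : SemiMackey T.mul) (X : GSet T.family) (a b : MOver M X),
        e M X a.cls + e M X b.cls = e M X (a.sum b).cls) ∧
      (∀ (M : SemiMackey T.mul) (X : GSet T.family) (a b : MOver M X),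
        e M X a.cls * e M X b.cls = e M X (a.prod b).cls) ∧
      (∀ (M : SemiMackey T.mul) {X Y : GSet T.family} (ζ : Y ⟶ X) (a : MOver M X),
        (S.obj M).res ζ (e M X a.cls) = e M Y (a.res ζ).cls) ∧
      (∀ (M : SemiMackey T.mul) {X Y : GSet T.family} (ξ : X ⟶ Y) (hξ : T.plus.IsTransfer ξ)
        (a : MOver M X), (S.obj M).add ξ hξ (e M X a.cls) = e M Y (a.add ξ hξ).cls) ∧
      (∀ (M : SemiMackey T.mul) {X Y : GSet T.family} (η : X ⟶ Y) (hη : T.mul.IsTransfer η)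
        (a : MOver M X), (S.obj M).mul η hη (e M X a.cls) = e M Y (a.mul η hη).cls) ∧
      (∀ {M N : SemiMackey T.mul} (φ : M ⟶ N) (X : GSet T.family) (a : MOver M X),
        (S.map φ).app X (e M X a.cls) = e N X (a.map φ).cls) := by
  exact ⟨tambarizationFunctor T, fun M X => (Shrink.ringEquiv (IsoClasses M X)).symm.toEquiv,
    fun M X a b => (map_add (Shrink.ringEquiv (IsoClasses M X)).symm a.cls b.cls).symm,
    fun M X a b => (map_mul (Shrink.ringEquiv (IsoClasses M X)).symm a.cls b.cls).symm,
    fun M _ _ ζ a => MOver.shrinkRes_toShrink (M := M) ζ a,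
    fun M _ _ ξ hξ a => MOver.shrinkAdd_toShrink (M := M) ξ hξ a,
    fun M _ _ η hη a => MOver.shrinkMul_toShrink (M := M) η hη a,
    fun φ _ a => MOver.shrinkMap_toShrink φ a⟩
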